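/- **Steepest-descent curve.** Let $C\subset\mathbb C$ consist of $0$ and of all $\theta$ with $\operatorname{Re}\theta\in(-\pi,\pi)\setminus\{0\}$ and $\operatorname{Im}(e^{i\theta}-i\theta)=0$. Let $\mathcal R=\{z:\operatorname{Re}z>-1,\ -\pi<\operatorname{Im}z<0\}$ and $\Omega=\{\theta:0<\operatorname{Re}\theta<\pi,\ \operatorname{Im}\theta<0\}$, let $\gamma$ be the positively oriented boundary of $\mathcal R$, and put $$W(z)=\frac{z}{2\pi i}\int_\gamma\frac{\xi+1}{\xi e^{\xi}-z}\,d\xi,\qquad \theta_+(\tau)=i\bigl(1-\tau^2+W(-e^{\tau^2-1})\bigr)\quad(\tau>0),$$ $\theta(\tau)=\theta_+(\tau)$ for $\tau>0$, $\theta(0)=0$, $\theta(\tau)=-\overline{\theta_+(-\tau)}$ for $\tau<0$. Then for $\tau>0$ the number $W(-e^{\tau^2-1})$ is the unique $w\in\mathcal R$ with $we^w=-e^{\tau^2-1}$, and $\theta(\tau)$ is the unique $\theta\in\Omega$ with $e^{i\theta}-i\theta=1-\tau^2$. The map $\theta:\mathbb R\to\mathbb C$ is $C^\infty$, $\theta'(\tau)\ne0$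 for all $\tau$, $\theta$ is a bijection of $\mathbb R$ onto $C$, and $e^{i\theta(\tau)}-i\theta(\tau)=1-\tau^2$ for all $\tau\in\mathbb R$. **Representation.** Let $g$ be entire with $g(0)\neq0$, let $p_n(x)=n!\,[z^n]\,e^{xz}/g(z)$ be its Appell polynomials and $\pi_n(x)=p_n(nx)$. Let $x\in\mathbb C\setminus\{0\}$, $n\in\{0,1,2,\dots\}$ and $F(\theta)=e^{n(e^{i\theta}-i\theta)}/g(e^{i\theta}/x)$. To each zero $\zeta_k$ of $g$ (the zeros being listed without multiplicity) associate the zero $\theta_k=\operatorname{Arg}(x\zeta_k)-i\log|x\zeta_k|$ of $g(e^{i\theta}/x)$, where $\operatorname{Arg}\in(-\pi,\pi]$. For $\operatorname{Re}\theta\in(-\pi,\pi)$ put $\psi(\theta)=\operatorname{Im}\theta-\log\frac{\sin\operatorname{Re}\theta}{\operatorname{Re}\theta}$ if $\operatorname{Re}\theta\ne0$ and $\psi(\theta)=\operatorname{Im}\theta$ if $\operatorname{Re}\theta=0$; put $\Theta(t)=1,\tfrac12,0$ for $t>0$, $t=0$, $t<0$, and read $\Theta(\psi(\theta))=1$ if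 $\operatorname{Re}\theta=\pi$. Assume: 1. every zero $\zeta_k$ of $g$ with $\theta_k\in C$ is simple; 2. $S\subset(0,\infty)$ is an unbounded set such that for $T\in S$ the two closed horizontal segments $c_1(T)$, from $-\pi+i\operatorname{Im}\theta(T)$ to $\theta(-T)$, and $c_2(T)$, from $\theta(T)$ to $\pi+i\operatorname{Im}\theta(T)$, contain no zero of $g(e^{i\theta}/x)$, and $\int_{c_1(T)}F\,d\theta+\int_{c_2(T)}F\,d\theta\to0$ as $T\to\infty$, $T\in S$; 3. the sum of the residues converges, in the sense that the finite sums over the $\theta_k$ with $\operatorname{Im}\theta_k>\operatorname{Im}\theta(T)$ converge as $T\to\infty$, $T\in S$: $$\sum_k\Theta(\psi(\theta_k))\operatorname{Res}(F;\theta_k):=\lim_{\substack{T\to\infty\\T\in S}}\ \sum_{k:\ \operatorname{Im}\theta_k>\operatorname{Im}\theta(T)}\Theta(\psi(\theta_k))\operatorname{Res}(F;\theta_k).$$ Then the principal value $$\mathrm{PV}\!\int_{-\infty}^{\infty}\frac{\theta'(\tau)e^{-n\tau^2}}{g(e^{i\theta(\tau)}/x)}\,d\tau:=\lim_{\substack{T\to\infty\\T\in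 S}}\ \lim_{\varepsilon\downarrow0}\int_{\{|\tau|\le T,\ |\tau-p|\ge\varepsilon\ \forall p\in P\}}\frac{\theta'(\tau)e^{-n\tau^2}}{g(e^{i\theta(\tau)}/x)}\,d\tau,\qquad P=\{\tau\in\mathbb R: g(e^{i\theta(\tau)}/x)=0\},$$ exists, and $$\frac{\pi_n(x)}{n!}=\frac{x^n}{2\pi}\left(e^n\,\mathrm{PV}\!\int_{-\infty}^{\infty}\frac{\theta'(\tau)e^{-n\tau^2}}{g(e^{i\theta(\tau)}/x)}\,d\tau-2\pi i\sum_k\Theta(\psi(\theta_k))\operatorname{Res}(F;\theta_k)\right).$$ -/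

import Mathlib

open Complex Set Filter Topology MeasureTheory
open scoped ContDiff

namespace Appell

noncomputable section

/-- The Appell polynomials of `g`: `p_n(x) = n! [z^n] (e^{xz} / g z)`, i.e. the `n`-th derivative
of `z ↦ e^{xz} / g z` at `0`. -/
def appell (g : ℂ → ℂ) (n : ℕ) (x : ℂ) : ℂ :=
  iteratedDeriv n (fun z : ℂ => cexp (x * z) / g z) 0

/-- The rescaled Appell polynomials `π_n(x) = p_n(n x)`. -/
def rescaledAppell (g : ℂ → ℂ) (n : ℕ) (x : ℂ) : ℂ := appell g n (n * x)

/-- The residue of `f` at `a`: the limit (eventually constant if `f` is meromorphic at `a`) of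
`(2πi)⁻¹ ∮ f` over small positively oriented circles about `a`. -/
def residue (f : ℂ → ℂ) (a : ℂ) : ℂ :=
  limUnder (𝓝[>] (0 : ℝ)) fun r => (2 * Real.pi * I)⁻¹ * ∮ z in C(a, r), f z

/-! ### The steepest-descent curve and its parametrization -/

/-- The steepest-descent curve through the saddle point `0`: the part of
`Im (e^{iθ} - iθ) = 0` in the strip `-π < Re θ < π`, without the points `≠ 0` of the imaginary
axis (which form the steepest-ascent curve). -/
def curveC : Set ℂ :=
  {θ | θ = 0 ∨
    (θ.re ∈ Ioo (-Real.pi) Real.pi ∧ θ.re ≠ 0 ∧ (cexp (I * θ) - I * θ).im = 0)}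

/-- The half-strip `0 < Re θ < π`, `Im θ < 0`. -/
def regionOmega : Set ℂ := {θ | θ.re ∈ Ioo 0 Real.pi ∧ θ.im < 0}

/-- The half-strip `Re z > -1`, `-π < Im z < 0`. -/
def regionR : Set ℂ := {z | -1 < z.re ∧ z.im ∈ Ioo (-Real.pi) 0}

/-- The integrand `(ξ + 1) / (ξ e^ξ - z)`. -/
def lambertKernel (z ξ : ℂ) : ℂ := (ξ + 1) / (ξ * cexp ξ - z)

/-- The branch `W(z) = z / (2πi) ∫_γ (ξ + 1) / (ξ e^ξ - z) dξ` of the Lambert function, where `γ`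
is the positively oriented boundary of `regionR`: the ray `[-1, +∞)` traversed leftwards, the
segment from `-1` down to `-1 - πi`, and the ray `[-1, +∞) - πi` traversed rightwards. -/
def lambertW (z : ℂ) : ℂ :=
  z / (2 * Real.pi * I) *
    (-(∫ t in Ioi (-1 : ℝ), lambertKernel z (t : ℂ))
      + I * (∫ y in (0 : ℝ)..(-Real.pi), lambertKernel z (-1 + y * I))
      + ∫ t in Ioi (-1 : ℝ), lambertKernel z (t - Real.pi * I))

/-- `θ₊(τ) = i (1 - τ² + W(-e^{τ² - 1}))`. -/
def thetaPlus (τ : ℝ) : ℂ :=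
  I * (1 - (τ : ℂ) ^ 2 + lambertW (-cexp ((τ : ℂ) ^ 2 - 1)))

/-- The parametrization `θ(τ)` of the steepest-descent curve. -/
def theta (τ : ℝ) : ℂ :=
  if 0 < τ then thetaPlus τ
  else if τ = 0 then 0
  else -(starRingEnd ℂ) (thetaPlus (-τ))

/-! ### The residue term -/

/-- The integrand `e^{n(e^{iθ} - iθ)} / g(e^{iθ}/x)`. -/
def integrand (g : ℂ → ℂ) (x : ℂ) (n : ℕ) (θ : ℂ) : ℂ :=
  cexp (n * (cexp (I * θ) - I * θ)) / g (cexp (I * θ) / x)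

/-- The zero `θ = Arg(xζ) - i log |xζ|` of `g(e^{iθ}/x)` in the strip `-π < Re θ ≤ π` that
corresponds to a zero `ζ` of `g`. -/
def thetaZero (x ζ : ℂ) : ℂ := (arg (x * ζ) : ℂ) - I * (Real.log ‖x * ζ‖ : ℂ)

/-- The step function with value `1/2` at `0`. -/
def stepTheta (t : ℝ) : ℝ := if 0 < t then 1 else if t = 0 then 1 / 2 else 0

/-- `ψ`, on the strip `-π < Re θ < π`; it is positive above the curve and zero on it. -/
def psi (θ : ℂ) : ℝ :=
  if θ.re = 0 then θ.im else θ.im - Real.log (Real.sin θ.re / θ.re)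

/-- The weight `Θ(ψ(θ))`. On the line `Re θ = π`, where `sin (Re θ) / Re θ = 0` and `ψ` is to be
read as `+∞`, every point is above the curve and the weight is `1`. -/
def weight (θ : ℂ) : ℝ := if θ.re = Real.pi then 1 else stepTheta (psi θ)

/-- The (finite) sum of the weighted residues at those `θ_k` whose imaginary part exceeds that of
the point `θ(T)` of the curve. -/
def residueSum (g : ℂ → ℂ) (x : ℂ) (n : ℕ) (T : ℝ) : ℂ :=
  ∑ᶠ ζ ∈ {ζ : ℂ | g ζ = 0 ∧ (theta T).im < (thetaZero x ζ).im},
    (weight (thetaZero x ζ) : ℂ) * residue (integrand g x n) (thetaZero x ζ)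

/-! ### The horizontal segments closing the contour -/

/-- No zero of `g(e^{iθ}/x)` lies on the two closed horizontal segments at height `Im θ(T)` that
join the lines `Re θ = ∓π` to the points `θ(-T)` and `θ(T)` of the curve. -/
def SegmentsFree (g : ℂ → ℂ) (x : ℂ) (T : ℝ) : Prop :=
  ∀ X ∈ Icc (-Real.pi) (theta (-T)).re ∪ Icc (theta T).re Real.pi,
    g (cexp (I * (X + (theta T).im * I)) / x) ≠ 0

/-- The contribution of these two segments to the contour integral. -/
def segmentContribution (g : ℂ → ℂ) (x : ℂ) (n : ℕ) (T : ℝ) : ℂ :=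
  (∫ X in (-Real.pi)..(theta (-T)).re, integrand g x n (X + (theta T).im * I))
    + ∫ X in (theta T).re..Real.pi, integrand g x n (X + (theta T).im * I)

/-! ### The principal-value integral -/

/-- `PV ∫_{-T}^{T} f = v`, with symmetric excisions at the points of `P`. -/
def HasPVIntegralUpTo (f : ℝ → ℂ) (P : Set ℝ) (T : ℝ) (v : ℂ) : Prop :=
  Tendsto (fun ε : ℝ => ∫ τ in {τ | τ ∈ Icc (-T) T ∧ ∀ p ∈ P, ε ≤ |τ - p|}, f τ)
    (𝓝[>] 0) (𝓝 v)

/-- `PV ∫_{-∞}^{∞} f = v`, with symmetric excisions at the points of `P`, as the limit of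
`PV ∫_{-T}^{T} f` for `T → ∞` in `S`. -/
def HasPVIntegral (f : ℝ → ℂ) (P : Set ℝ) (S : Set ℝ) (v : ℂ) : Prop :=
  ∃ J : ℝ → ℂ, (∀ T ∈ S, HasPVIntegralUpTo f P T (J T)) ∧ Tendsto J (atTop ⊓ 𝓟 S) (𝓝 v)

end

end Appell

namespace Appell

/-! ### The curve as a graph over the real part -/

/-! Write θ = a + ib. Off the imaginary axis, Im(e^{iθ} - iθ) = 0 reads e^{-b} sin a = a, so the
curve is the graph b = log sinc a (`eq_graphPt`). On it e^{iθ} - iθ has the real value `level a`,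
which is even and falls strictly from 1 to -∞ on [0, π) (`strictAntiOn_level`). Hence each τ > 0
gives exactly one point with a > 0 and value 1 - τ². The substitution w = -iθ - 1 + τ² = -e^{iθ}
turns it into the root of w e^w = -e^{τ² - 1} in the half-strip, and Cauchy's formula on long
rectangles shows that the contour integral W equals this root (`lambertW_eq`). Smoothness off 0 is
the inverse function theorem; at the saddle one inverts a holomorphic square root of 1 - (e^{iθ} -
iθ) (`theta_at_zero`).

For the representation put w = e^{iθ}. Then F dθ = -i G(w) dw with G(w) = e^{nw} / (w^{n+1} g(w/x)).
The lines Re θ = ±π have the same image, so the curve for |τ| ≤ T and the two segments become a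
closed path around 0, which is a polar graph because arg w = Re θ. The residue of G at 0 is the
Appell coefficient; the other poles give the residue sum.

The residue theorem with poles on the path is obtained from explicit primitives. On a disc
containing the path, G = Σ c_a/(w - a) + E' (`exists_partialFraction`), where E is holomorphic near
the path because only simple poles lie on it; so E' integrates to 0. For each fraction, logarithms
give the winding number 1, 0 or, as a principal value at a point of the curve, 1/2
(`hasPV_simpleFraction`). These numbers are exactly the weights Θ(ψ). The result is a closed formula
at each level T (`hasPVIntegralUpTo_level`), and T → ∞ in S finishes the proof. -/

lemma sinc_pos {a : ℝ} (ha : a ∈ Ioo (-Real.pi) Real.pi) : 0 < Real.sinc a := by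
  have key : ∀ b : ℝ, 0 < b → b < Real.pi → 0 < Real.sinc b := fun b h0 h1 => by
    rw [Real.sinc_of_ne_zero h0.ne']
    exact div_pos (Real.sin_pos_of_pos_of_lt_pi h0 h1) h0
  rcases lt_trichotomy a 0 with h | h | h
  · rw [← Real.sinc_neg]
    exact key _ (by linarith) (by linarith [ha.1])
  · simp [h]
  · exact key a h ha.2

lemma mul_sinc (a : ℝ) : a * Real.sinc a = Real.sin a := by
  rcases eq_or_ne a 0 with h | h
  · simp [h]
  · rw [Real.sinc_of_ne_zero h]; field_simp

/-- The derivative of sin t - t cos t is t sin t > 0. The inequality makes sinc decreasing and later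
puts the Lambert root to the right of Re = -1. -/
lemma mul_cos_lt_sin {a : ℝ} (h0 : 0 < a) (h1 : a < Real.pi) : a * Real.cos a < Real.sin a := by
  have hm : StrictMonoOn (fun t : ℝ => Real.sin t - t * Real.cos t) (Icc 0 Real.pi) := by
    refine strictMonoOn_of_deriv_pos (convex_Icc _ _) (by fun_prop) fun t ht => ?_
    rw [interior_Icc] at ht
    have : HasDerivAt (fun t : ℝ => Real.sin t - t * Real.cos t)
        (Real.cos t - (1 * Real.cos t + t * -Real.sin t)) t :=
      (Real.hasDerivAt_sin t).sub ((hasDerivAt_id t).mul (Real.hasDerivAt_cos t))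
    rw [this.deriv]
    have := mul_pos ht.1 (Real.sin_pos_of_pos_of_lt_pi ht.1 ht.2)
    linarith
  have := hm (left_mem_Icc.2 Real.pi_pos.le) ⟨h0.le, h1.le⟩ h0
  simp only [Real.sin_zero, zero_mul, sub_zero] at this
  linarith

lemma hasDerivAt_sinc {a : ℝ} (h : a ≠ 0) :
    HasDerivAt Real.sinc ((a * Real.cos a - Real.sin a) / a ^ 2) a := by
  have h1 : HasDerivAt (fun t : ℝ => Real.sin t / t) ((Real.cos a * a - Real.sin a * 1) / a ^ 2) a :=
    (Real.hasDerivAt_sin a).div (hasDerivAt_id a) h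
  refine (h1.congr_of_eventuallyEq ?_).congr_deriv (by ring)
  filter_upwards [isOpen_ne.mem_nhds h] with t ht using Real.sinc_of_ne_zero ht

lemma strictAntiOn_sinc : StrictAntiOn Real.sinc (Ico 0 Real.pi) := by
  refine strictAntiOn_of_deriv_neg (convex_Ico _ _) Real.continuous_sinc.continuousOn fun t ht => ?_
  rw [interior_Ico] at ht
  rw [(hasDerivAt_sinc ht.1.ne').deriv]
  exact div_neg_of_neg_of_pos (by linarith [mul_cos_lt_sin ht.1 ht.2]) (pow_pos ht.1 2)

/-- The value of `e^{iθ} - iθ` at the point of the curve with real part `a`. -/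
noncomputable def level (a : ℝ) : ℝ := Real.cos a / Real.sinc a + Real.log (Real.sinc a)

/-- The point of the curve with real part `a`. -/
noncomputable def graphPt (a : ℝ) : ℂ := a + Real.log (Real.sinc a) * I

@[simp] lemma graphPt_re (a : ℝ) : (graphPt a).re = a := by simp [graphPt]

@[simp] lemma graphPt_im (a : ℝ) : (graphPt a).im = Real.log (Real.sinc a) := by simp [graphPt]

lemma level_zero : level 0 = 1 := by simp [level]

lemma level_neg (a : ℝ) : level (-a) = level a := by simp [level]

lemma continuousOn_level : ContinuousOn level (Ioo (-Real.pi) Real.pi) :=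
  (Real.continuous_cos.continuousOn.div Real.continuous_sinc.continuousOn
    fun _ ha => (sinc_pos ha).ne').add
    (Real.continuous_sinc.continuousOn.log fun _ ha => (sinc_pos ha).ne')

lemma Ico_subset_strip : Ico 0 Real.pi ⊆ Ioo (-Real.pi) Real.pi := fun a ha =>
  ⟨by linarith [ha.1, Real.pi_pos], ha.2⟩

/-- The derivative simplifies to minus a sum of two squares over t sin² t, hence is negative. -/
lemma strictAntiOn_level : StrictAntiOn level (Ico 0 Real.pi) := by
  refine strictAntiOn_of_deriv_neg (convex_Ico _ _) (continuousOn_level.mono Ico_subset_strip)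
    fun t ht => ?_
  rw [interior_Ico] at ht
  have hs := Real.sin_pos_of_pos_of_lt_pi ht.1 ht.2
  have hp : 0 < Real.sinc t := sinc_pos (Ico_subset_strip ⟨ht.1.le, ht.2⟩)
  have hd := hasDerivAt_sinc ht.1.ne'
  have h2 : HasDerivAt level _ t := ((Real.hasDerivAt_cos t).div hd hp.ne').add (hd.log hp.ne')
  rw [h2.deriv, Real.sinc_of_ne_zero ht.1.ne']
  have ht0 := ht.1
  have : (-Real.sin t * (Real.sin t / t) - Real.cos t * ((t * Real.cos t - Real.sin t) / t ^ 2)) /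
      (Real.sin t / t) ^ 2 + (t * Real.cos t - Real.sin t) / t ^ 2 / (Real.sin t / t)
      = -((Real.sin t - t * Real.cos t) ^ 2 + (t * Real.sin t) ^ 2) / (t * Real.sin t ^ 2) := by
    field_simp
    ring
  rw [this]
  have : 0 < t * Real.sin t := mul_pos ht0 hs
  exact div_neg_of_neg_of_pos (neg_neg_of_pos (by positivity)) (by positivity)

/-- Intermediate values: the level is 1 at 0 and tends to -∞ at π, since there cos ≤ 0 while log
sinc → -∞. -/
lemma exists_level_eq {c : ℝ} (hc : c ≤ 1) : ∃ a ∈ Ico 0 Real.pi, level a = c := by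
  have hpi := Real.pi_pos
  obtain ⟨b, hb, hbc⟩ : ∃ b ∈ Ico 0 Real.pi, level b ≤ c := by
    have h1 : ∀ᶠ b in 𝓝[<] Real.pi, Real.sinc b < Real.exp c := by
      have : Tendsto Real.sinc (𝓝[<] Real.pi) (𝓝 (Real.sinc Real.pi)) :=
        Real.continuous_sinc.continuousAt.mono_left nhdsWithin_le_nhds
      refine this.eventually_lt_const ?_
      rw [Real.sinc_of_ne_zero hpi.ne']
      simpa using Real.exp_pos c
    have h2 : ∀ᶠ b in 𝓝[<] Real.pi, b ∈ Ioo (Real.pi / 2) Real.pi :=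
      Ioo_mem_nhdsLT (by linarith)
    obtain ⟨b, hb1, hb2⟩ := (h1.and h2).exists
    have hb : b ∈ Ico 0 Real.pi := ⟨by linarith [hb2.1], hb2.2⟩
    refine ⟨b, hb, ?_⟩
    have hp := sinc_pos (Ico_subset_strip hb)
    have h3 : Real.cos b ≤ 0 :=
      Real.cos_nonpos_of_pi_div_two_le_of_le hb2.1.le (by linarith [hb2.2])
    have h4 : Real.log (Real.sinc b) ≤ c := ((Real.log_lt_iff_lt_exp hp).2 hb1).le
    have := div_nonpos_of_nonpos_of_nonneg h3 hp.le
    unfold level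
    linarith
  have hcont : ContinuousOn level (Icc 0 b) :=
    continuousOn_level.mono fun t ht => Ico_subset_strip ⟨ht.1, ht.2.trans_lt hb.2⟩
  obtain ⟨a, ha, hac⟩ := intermediate_value_Icc' hb.1 hcont
    (show c ∈ Icc (level b) (level 0) from ⟨hbc, by rwa [level_zero]⟩)
  exact ⟨a, ⟨ha.1, ha.2.trans_lt hb.2⟩, hac⟩

lemma exp_sub_re (θ : ℂ) : (cexp (I * θ) - I * θ).re = Real.exp (-θ.im) * Real.cos θ.re + θ.im := by
  simp [exp_re]

lemma exp_sub_im (θ : ℂ) : (cexp (I * θ) - I * θ).im = Real.exp (-θ.im) * Real.sin θ.re - θ.re := by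
  simp [exp_im]

lemma exp_neg_log_sinc {a : ℝ} (ha : a ∈ Ioo (-Real.pi) Real.pi) :
    Real.exp (-Real.log (Real.sinc a)) = (Real.sinc a)⁻¹ := by
  rw [Real.exp_neg, Real.exp_log (sinc_pos ha)]

lemma exp_sub_graphPt {a : ℝ} (ha : a ∈ Ioo (-Real.pi) Real.pi) :
    cexp (I * graphPt a) - I * graphPt a = level a := by
  have hp := sinc_pos ha
  apply Complex.ext
  · rw [exp_sub_re, ofReal_re, graphPt_re, graphPt_im, exp_neg_log_sinc ha, level]
    ring
  · rw [exp_sub_im, ofReal_im, graphPt_re, graphPt_im, exp_neg_log_sinc ha, ← mul_sinc a]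
    field_simp
    ring

/-- Since sin a = a sinc a, cancelling a ≠ 0 leaves e^{-b} sinc a = 1, which determines b. -/
lemma eq_graphPt {θ : ℂ} (h : θ.re ∈ Ioo (-Real.pi) Real.pi) (h0 : θ.re ≠ 0)
    (him : (cexp (I * θ) - I * θ).im = 0) : θ = graphPt θ.re := by
  have hp := sinc_pos h
  rw [exp_sub_im, ← mul_sinc, sub_eq_zero] at him
  have h1 : Real.exp (-θ.im) * Real.sinc θ.re = 1 := by
    apply mul_left_cancel₀ h0
    linear_combination him
  have h2 : Real.log (Real.sinc θ.re) = θ.im := by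
    have := congrArg Real.log h1
    rw [Real.log_mul (Real.exp_pos _).ne' hp.ne', Real.log_exp, Real.log_one] at this
    linarith
  apply Complex.ext <;> simp [h2]

lemma log_sinc_neg {a : ℝ} (h : a ∈ Ioo (-Real.pi) Real.pi) (h0 : a ≠ 0) :
    Real.log (Real.sinc a) < 0 := by
  have key : ∀ b : ℝ, 0 < b → b < Real.pi → Real.log (Real.sinc b) < 0 := fun b hb hb' => by
    refine Real.log_neg (sinc_pos ⟨by linarith [Real.pi_pos], hb'⟩) ?_
    have := strictAntiOn_sinc ⟨le_rfl, Real.pi_pos⟩ ⟨hb.le, hb'⟩ hb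
    simpa using this
  rcases lt_or_gt_of_ne h0 with h1 | h1
  · rw [← Real.sinc_neg]
    exact key _ (by linarith) (by linarith [h.1])
  · exact key a h1 h.2

lemma level_lt_one {a : ℝ} (h : a ∈ Ioo (-Real.pi) Real.pi) (h0 : a ≠ 0) : level a < 1 := by
  have key : ∀ b : ℝ, 0 < b → b < Real.pi → level b < 1 := fun b hb hb' => by
    rw [← level_zero]
    exact strictAntiOn_level ⟨le_rfl, Real.pi_pos⟩ ⟨hb.le, hb'⟩ hb
  rcases lt_or_gt_of_ne h0 with h1 | h1
  · rw [← level_neg]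
    exact key _ (by linarith) (by linarith [h.1])
  · exact key a h1 h.2

/-! ### The parameter τ and the Lambert equation -/

/-- The angle of the solution of `e^{iθ} - iθ = 1 - τ²` with nonnegative real part. -/
noncomputable def angle (τ : ℝ) : ℝ :=
  (exists_level_eq (c := 1 - τ ^ 2) (by nlinarith [sq_nonneg τ])).choose

lemma angle_mem (τ : ℝ) : angle τ ∈ Ico 0 Real.pi :=
  (exists_level_eq (c := 1 - τ ^ 2) (by nlinarith [sq_nonneg τ])).choose_spec.1

lemma level_angle (τ : ℝ) : level (angle τ) = 1 - τ ^ 2 :=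
  (exists_level_eq (c := 1 - τ ^ 2) (by nlinarith [sq_nonneg τ])).choose_spec.2

lemma angle_pos {τ : ℝ} (h : 0 < τ) : 0 < angle τ := by
  refine lt_of_le_of_ne (angle_mem τ).1 fun h0 => ?_
  have := level_angle τ
  rw [← h0, level_zero] at this
  nlinarith

/-- The solution of `e^{iθ} - iθ = 1 - τ²` in `regionOmega` is unique. -/
lemma eq_graphPt_angle {τ : ℝ} {θ : ℂ} (h : θ.re ∈ Ioo 0 Real.pi)
    (hθ : cexp (I * θ) - I * θ = 1 - (τ : ℂ) ^ 2) : θ = graphPt (angle τ) := by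
  have hs : θ.re ∈ Ioo (-Real.pi) Real.pi := ⟨by linarith [h.1, Real.pi_pos], h.2⟩
  have hc : (1 - (τ : ℂ) ^ 2) = ((1 - τ ^ 2 : ℝ) : ℂ) := by push_cast; ring
  have h1 : θ = graphPt θ.re := eq_graphPt hs h.1.ne' (by rw [hθ, hc, ofReal_im])
  have h2 : level θ.re = 1 - τ ^ 2 := by
    rw [h1, exp_sub_graphPt hs, hc] at hθ
    exact_mod_cast hθ
  have h3 : θ.re = angle τ :=
    strictAntiOn_level.injOn ⟨h.1.le, h.2⟩ (angle_mem τ) (h2.trans (level_angle τ).symm)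
  rw [h1, h3]

lemma exp_sub_graphPt_angle (τ : ℝ) :
    cexp (I * graphPt (angle τ)) - I * graphPt (angle τ) = 1 - (τ : ℂ) ^ 2 := by
  rw [exp_sub_graphPt (Ico_subset_strip (angle_mem τ)), level_angle]
  push_cast
  ring

/-- The solution of `w e^w = -e^{τ² - 1}` in `regionR`. -/
noncomputable def lambertSol (τ : ℝ) : ℂ := -I * graphPt (angle τ) - 1 + (τ : ℂ) ^ 2

/-- The two expressions -iθ - 1 + τ² and -e^{iθ} for the same w give w e^w at once: the factors
e^{iθ} and e^{-iθ} cancel. -/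
lemma lambertSol_eq (τ : ℝ) : lambertSol τ = -cexp (I * graphPt (angle τ)) := by
  have := exp_sub_graphPt_angle τ
  rw [lambertSol]
  linear_combination this

lemma lambertSol_im (τ : ℝ) : (lambertSol τ).im = -angle τ := by
  have : ((τ : ℂ) ^ 2).im = 0 := by rw [← ofReal_pow, ofReal_im]
  simp [lambertSol, this]

lemma lambertSol_mem {τ : ℝ} (h : 0 < τ) : lambertSol τ ∈ regionR := by
  have ha := angle_mem τ
  have hs := Ico_subset_strip ha
  have hp := sinc_pos hs
  refine ⟨?_, ?_⟩
  · rw [lambertSol_eq]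
    simp only [neg_re, exp_re, mul_re, I_re, I_im, mul_im, graphPt_re, graphPt_im]
    -- The real part of -e^{iθ} is -cos a / sinc a, so Re w > -1 amounts to a cos a < sin a.
    have := mul_cos_lt_sin (angle_pos h) ha.2
    rw [← mul_sinc] at this
    have := lt_of_mul_lt_mul_left this (angle_pos h).le
    have h3 : Real.cos (angle τ) / Real.sinc (angle τ) < 1 := (div_lt_one hp).2 this
    have h4 := exp_neg_log_sinc hs
    simp only [zero_mul, one_mul, zero_sub, zero_add, h4]
    rw [inv_mul_eq_div]
    linarith
  · rw [lambertSol_im]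
    exact ⟨by linarith [ha.2], by linarith [angle_pos h]⟩

lemma lambertSol_mul_exp (τ : ℝ) :
    lambertSol τ * cexp (lambertSol τ) = -cexp ((τ : ℂ) ^ 2 - 1) := by
  nth_rewrite 1 [lambertSol_eq]
  rw [lambertSol, neg_mul, ← Complex.exp_add]
  congr 2
  ring

/-- Uniqueness of the solution of `w e^w = -e^{τ² - 1}` in the strip `-π < Im w < 0`. -/
lemma eq_lambertSol {τ : ℝ} {w : ℂ} (h : w.im ∈ Ioo (-Real.pi) 0)
    (hw : w * cexp w = -cexp ((τ : ℂ) ^ 2 - 1)) : w = lambertSol τ := by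
  have him : ((τ : ℂ) ^ 2).im = 0 := by rw [← ofReal_pow, ofReal_im]
  -- Inverse substitution: θ = i(1 - τ² + w) has Re θ = -Im w and solves e^{iθ} - iθ = 1 - τ², so
  -- uniqueness on the curve applies.
  have h1 : I * (1 - (τ : ℂ) ^ 2 + w) = graphPt (angle τ) := by
    apply eq_graphPt_angle
    · simp [him]
      exact ⟨h.2, by linarith [h.1]⟩
    · have h2 : I * (I * (1 - (τ : ℂ) ^ 2 + w)) = ((τ : ℂ) ^ 2 - 1) + -w := by
        linear_combination (1 - (τ : ℂ) ^ 2 + w) * I_mul_I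
      have h3 : cexp w * cexp (-w) = 1 := by rw [← Complex.exp_add]; simp
      rw [h2, Complex.exp_add]
      linear_combination cexp (-w) * hw - w * h3
  rw [lambertSol, ← h1]
  linear_combination (1 - (τ : ℂ) ^ 2 + w) * I_mul_I

/-! ### Logarithms along paths and the Cauchy formula for rectangles -/

/-- A half-turn of the argument. Two of them make the 2πi of a rectangle; a single one makes the
half residue at a pole on the curve. -/
lemma log_sub_log_neg {c : ℂ} (hc : 0 < c.im) : log c - log (-c) = Real.pi * I := by
  rw [log, log, norm_neg, arg_neg_eq_arg_sub_pi_of_im_pos hc]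
  push_cast
  ring

lemma integral_logDeriv {φ φ' : ℝ → ℂ} {a b : ℝ} (hφ : ∀ t ∈ uIcc a b, HasDerivAt φ (φ' t) t)
    (hc : ContinuousOn φ' (uIcc a b)) (hs : ∀ t ∈ uIcc a b, φ t ∈ slitPlane) :
    ∫ t in a..b, φ' t / φ t = log (φ b) - log (φ a) := by
  refine intervalIntegral.integral_eq_sub_of_hasDerivAt (f := fun t => log (φ t))
    (fun t ht => (hφ t ht).clog_real (hs t ht)) (ContinuousOn.intervalIntegrable ?_)
  exact hc.div (fun t ht => (hφ t ht).continuousAt.continuousWithinAt)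
    fun t ht => slitPlane_ne_zero (hs t ht)

/-- The integral along the positively oriented boundary of the rectangle with opposite vertices
`z` (lower left) and `w` (upper right). -/
noncomputable def rectInt (f : ℂ → ℂ) (z w : ℂ) : ℂ :=
  (∫ x : ℝ in z.re..w.re, f (x + z.im * I)) - (∫ x : ℝ in z.re..w.re, f (x + w.im * I)) +
      I * (∫ y : ℝ in z.im..w.im, f (w.re + y * I)) - I * (∫ y : ℝ in z.im..w.im, f (z.re + y * I))

lemma hasDerivAt_horizontal (c : ℂ) (t : ℝ) : HasDerivAt (fun x : ℝ => (x : ℂ) + c) 1 t :=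
  (hasDerivAt_id t).ofReal_comp.add_const c

lemma hasDerivAt_vertical (c : ℂ) (t : ℝ) : HasDerivAt (fun y : ℝ => c + (y : ℂ) * I) I t := by
  simpa using ((hasDerivAt_id t).ofReal_comp.mul_const I).const_add c

/-- The principal log(ξ - p) is a primitive on three sides. The left side crosses the cut, so
log(-(ξ - p)) is used there; the mismatches at the two left corners are πi each. -/
lemma rectInt_inv_sub {z w p : ℂ} (hre : p.re ∈ Ioo z.re w.re) (him : p.im ∈ Ioo z.im w.im) :
    rectInt (fun ξ => (ξ - p)⁻¹) z w = 2 * Real.pi * I := by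
  have hor : ∀ y : ℝ, y ≠ p.im → ∫ x : ℝ in z.re..w.re, ((x : ℂ) + y * I - p)⁻¹
      = log ((w.re : ℂ) + y * I - p) - log ((z.re : ℂ) + y * I - p) := fun y hy => by
    have := integral_logDeriv (φ := fun x : ℝ => (x : ℂ) + y * I - p) (φ' := fun _ => 1)
      (a := z.re) (b := w.re)
      (fun t _ => by simpa using (hasDerivAt_horizontal (y * I) t).sub_const p) continuousOn_const
      (fun t _ => mem_slitPlane_iff.2 (Or.inr (by simpa using sub_ne_zero.2 hy)))
    simpa using this
  have vert : ∀ x : ℝ, p.re < x → I * ∫ y : ℝ in z.im..w.im, ((x : ℂ) + y * I - p)⁻¹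
      = log ((x : ℂ) + w.im * I - p) - log ((x : ℂ) + z.im * I - p) := fun x hx => by
    have := integral_logDeriv (φ := fun y : ℝ => (x : ℂ) + y * I - p) (φ' := fun _ => I)
      (a := z.im) (b := w.im)
      (fun t _ => by simpa using (hasDerivAt_vertical x t).sub_const p) continuousOn_const
      (fun t _ => mem_slitPlane_iff.2 (Or.inl (by simpa using hx)))
    rw [← this, ← intervalIntegral.integral_const_mul]
    simp [div_eq_mul_inv]
  have vert' : ∀ x : ℝ, x < p.re → I * ∫ y : ℝ in z.im..w.im, ((x : ℂ) + y * I - p)⁻¹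
      = log (-((x : ℂ) + w.im * I - p)) - log (-((x : ℂ) + z.im * I - p)) := fun x hx => by
    have := integral_logDeriv (φ := fun y : ℝ => -((x : ℂ) + y * I - p)) (φ' := fun _ => -I)
      (a := z.im) (b := w.im)
      (fun t _ => ((hasDerivAt_vertical x t).sub_const p).neg) continuousOn_const
      (fun t _ => mem_slitPlane_iff.2 (Or.inl (by simpa using hx)))
    rw [← this, ← intervalIntegral.integral_const_mul]
    exact intervalIntegral.integral_congr fun t _ => by
      rw [neg_div_neg_eq, div_eq_mul_inv]
  have h1 := log_sub_log_neg (c := (z.re : ℂ) + w.im * I - p) (by simpa using him.2)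
  have h2 := log_sub_log_neg (c := -((z.re : ℂ) + z.im * I - p)) (by simpa using him.1)
  rw [neg_neg] at h2
  rw [rectInt, hor _ him.1.ne, hor _ him.2.ne', vert _ hre.2, vert' _ hre.1]
  linear_combination h1 + h2

/-- Split f(ξ)/(ξ - p) into the difference quotient, holomorphic on the rectangle and so with
integral 0, and f(p)/(ξ - p). -/
lemma rectInt_cauchy {f : ℂ → ℂ} {z w p : ℂ} (hre : p.re ∈ Ioo z.re w.re)
    (him : p.im ∈ Ioo z.im w.im) (hf : DifferentiableOn ℂ f (Icc z.re w.re ×ℂ Icc z.im w.im)) :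
    rectInt (fun ξ => f ξ / (ξ - p)) z w = 2 * Real.pi * I * f p := by
  have hz := (hre.1.trans hre.2).le
  have hz' := (him.1.trans him.2).le
  set Q := Icc z.re w.re ×ℂ Icc z.im w.im with hQ
  have hn : Q ∈ 𝓝 p := by
    refine mem_of_superset (IsOpen.mem_nhds ((isOpen_Ioo (a := z.re) (b := w.re)).reProdIm
      (isOpen_Ioo (a := z.im) (b := w.im))) ⟨hre, him⟩) ?_
    exact fun ξ hξ => ⟨Ioo_subset_Icc_self hξ.1, Ioo_subset_Icc_self hξ.2⟩
  have hd : DifferentiableOn ℂ (dslope f p) Q := (differentiableOn_dslope hn).2 hf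
  have h0 : rectInt (dslope f p) z w = 0 := by
    have := integral_boundary_rect_eq_zero_of_differentiableOn (dslope f p) z w
      (by rwa [uIcc_of_le hz, uIcc_of_le hz'])
    simpa [rectInt] using this
  have hsplit : ∀ ξ, ξ ≠ p → f ξ / (ξ - p) = dslope f p ξ + f p * (ξ - p)⁻¹ := fun ξ hξ => by
    have := sub_ne_zero.2 hξ
    rw [dslope_of_ne _ hξ, slope_def_field]
    field_simp
    ring
  have side : ∀ (γ : ℝ → ℂ) (a b : ℝ), a ≤ b → Continuous γ → (∀ t ∈ Icc a b, γ t ∈ Q ∧ γ t ≠ p) →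
      ∫ t in a..b, f (γ t) / (γ t - p)
        = (∫ t in a..b, dslope f p (γ t)) + f p * ∫ t in a..b, (γ t - p)⁻¹ := by
    intro γ a b hab hγ hm
    rw [← intervalIntegral.integral_const_mul, ← intervalIntegral.integral_add]
    · refine intervalIntegral.integral_congr fun t ht => ?_
      rw [uIcc_of_le hab] at ht
      exact hsplit _ (hm t ht).2
    · refine ContinuousOn.intervalIntegrable ?_
      rw [uIcc_of_le hab]
      exact hd.continuousOn.comp hγ.continuousOn fun t ht => (hm t ht).1
    · refine ContinuousOn.intervalIntegrable ?_
      rw [uIcc_of_le hab]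
      exact continuousOn_const.mul
        ((hγ.sub continuous_const).continuousOn.inv₀ fun t ht => sub_ne_zero.2 (hm t ht).2)
  have s1 := side (fun x => x + z.im * I) _ _ hz (by fun_prop) fun t ht =>
    ⟨by simpa [hQ, mem_reProdIm, hz'] using ht, fun h => him.1.ne (by simp [← h])⟩
  have s2 := side (fun x => x + w.im * I) _ _ hz (by fun_prop) fun t ht =>
    ⟨by simpa [hQ, mem_reProdIm, hz'] using ht, fun h => him.2.ne' (by simp [← h])⟩
  have s3 := side (fun y => w.re + y * I) _ _ hz' (by fun_prop) fun t ht =>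
    ⟨by simpa [hQ, mem_reProdIm, hz] using ht, fun h => hre.2.ne' (by simp [← h])⟩
  have s4 := side (fun y => z.re + y * I) _ _ hz' (by fun_prop) fun t ht =>
    ⟨by simpa [hQ, mem_reProdIm, hz] using ht, fun h => hre.1.ne (by simp [← h])⟩
  have h1 := rectInt_inv_sub hre him
  unfold rectInt at h0 h1 ⊢
  rw [s1, s2, s3, s4]
  linear_combination h0 + f p * h1

/-! ### The Lambert function -/

/-- On Im ξ = -π the imaginary part of ξ e^ξ is π e^{Re ξ} ≠ 0. On the real line t e^t ≥ -1/e >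
-e^{τ² - 1}, which needs τ ≠ 0. Inside the strip the root is unique. -/
lemma mul_exp_ne {τ : ℝ} (hτ : 0 < τ) {ξ : ℂ} (him : ξ.im ∈ Icc (-Real.pi) 0)
    (hne : ξ ≠ lambertSol τ) : ξ * cexp ξ - -cexp ((τ : ℂ) ^ 2 - 1) ≠ 0 := by
  rw [sub_ne_zero]
  intro h
  have hz : -cexp ((τ : ℂ) ^ 2 - 1) = ((-Real.exp (τ ^ 2 - 1) : ℝ) : ℂ) := by push_cast; rfl
  rcases eq_or_lt_of_le him.1 with h1 | h1
  · have := congrArg Complex.im h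
    rw [hz, ofReal_im, mul_im, exp_re, exp_im, ← h1] at this
    simp [Real.pi_ne_zero] at this
  rcases eq_or_lt_of_le him.2 with h2 | h2
  · have := congrArg Complex.re h
    rw [hz, ofReal_re, mul_re, exp_re, exp_im, h2] at this
    simp only [Real.cos_zero, Real.sin_zero, mul_one, mul_zero, sub_zero] at this
    have h3 := Real.add_one_le_exp (-ξ.re - 1)
    have h4 : Real.exp (-ξ.re - 1) * Real.exp ξ.re = Real.exp (-1) := by
      rw [← Real.exp_add]; ring_nf
    have h5 : Real.exp (-1) < Real.exp (τ ^ 2 - 1) := Real.exp_lt_exp.2 (by nlinarith)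
    nlinarith [Real.exp_pos ξ.re]
  · exact hne (eq_lambertSol ⟨h1, h2⟩ h)

lemma lambertSol_add_one_ne {τ : ℝ} (hτ : 0 < τ) : lambertSol τ + 1 ≠ 0 := fun h => by
  have := congrArg Complex.re h
  have h2 := (lambertSol_mem hτ).1
  simp at this
  linarith

lemma norm_lambertKernel_le {z ξ : ℂ} (h1 : 1 ≤ ξ.re) (h2 : 2 * ‖z‖ ≤ ξ.re) :
    ‖lambertKernel z ξ‖ ≤ 4 * Real.exp (-ξ.re) := by
  have h3 : ξ.re ≤ ‖ξ‖ := re_le_norm ξ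
  have h4 : 1 ≤ Real.exp ξ.re := Real.one_le_exp (by linarith)
  have h5 : ‖ξ‖ * Real.exp ξ.re / 2 ≤ ‖ξ * cexp ξ - z‖ := by
    have h6 := norm_sub_norm_le (ξ * cexp ξ) z
    rw [norm_mul, norm_exp] at h6
    nlinarith
  have h7 : ‖ξ + 1‖ ≤ 2 * ‖ξ‖ := (norm_add_le _ _).trans (by rw [norm_one]; linarith)
  have h0 : 0 < ‖ξ‖ := by linarith
  have h8 : 0 < ‖ξ‖ * Real.exp ξ.re / 2 := by positivity
  rw [lambertKernel, norm_div, div_le_iff₀ (h8.trans_le h5)]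
  calc ‖ξ + 1‖ ≤ 2 * ‖ξ‖ := h7
    _ = 4 * Real.exp (-ξ.re) * (‖ξ‖ * Real.exp ξ.re / 2) := by
      have : Real.exp (-ξ.re) * Real.exp ξ.re = 1 := by rw [← Real.exp_add]; simp
      linear_combination (-2 * ‖ξ‖) * this
    _ ≤ _ := by gcongr

lemma differentiable_mul_exp_sub (z : ℂ) : Differentiable ℂ fun ξ : ℂ => ξ * cexp ξ - z := by
  fun_prop

/-- Let φ(ξ) = ξ e^ξ - z and let p be its root. The quotient φ(ξ)/(ξ - p) has no zero in the closed
strip, so Cauchy's formula yields (p + 1)/φ'(p) = e^{-p}, and z e^{-p} = p. -/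
lemma rectInt_lambertKernel {τ N : ℝ} (hτ : 0 < τ) (hN : (lambertSol τ).re < N) :
    -cexp ((τ : ℂ) ^ 2 - 1) *
      rectInt (lambertKernel (-cexp ((τ : ℂ) ^ 2 - 1))) (-1 - Real.pi * I) N
      = 2 * Real.pi * I * lambertSol τ := by
  set p := lambertSol τ with hp
  set z := -cexp ((τ : ℂ) ^ 2 - 1) with hz
  have hpz : p * cexp p = z := lambertSol_mul_exp τ
  set φ : ℂ → ℂ := fun ξ => ξ * cexp ξ - z with hφ
  have hφd : Differentiable ℂ φ := differentiable_mul_exp_sub z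
  have hφp : φ p = 0 := sub_eq_zero.2 hpz
  have hd' : deriv φ p = (p + 1) * cexp p := by
    have : HasDerivAt φ (1 * cexp p + p * cexp p) p :=
      ((hasDerivAt_id p).mul (Complex.hasDerivAt_exp p)).sub_const z
    rw [this.deriv]; ring
  have hmul : ∀ ξ, (ξ - p) * dslope φ p ξ = φ ξ := fun ξ => by
    simpa [hφp] using sub_smul_dslope φ p ξ
  have hD : Differentiable ℂ (dslope φ p) := by
    rw [← differentiableOn_univ] at hφd ⊢
    exact (differentiableOn_dslope univ_mem).2 hφd
  have hDne : ∀ ξ : ℂ, ξ.im ∈ Icc (-Real.pi) 0 → dslope φ p ξ ≠ 0 := fun ξ hξ h => by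
    rcases eq_or_ne ξ p with h1 | h1
    · rw [h1, dslope_same, hd'] at h
      exact mul_ne_zero (lambertSol_add_one_ne hτ) (Complex.exp_ne_zero _) h
    · apply mul_exp_ne hτ hξ h1
      have := hmul ξ
      rw [h, mul_zero] at this
      exact this.symm
  have hmem := lambertSol_mem hτ
  have hc := rectInt_cauchy (f := fun ξ => (ξ + 1) / dslope φ p ξ) (z := -1 - Real.pi * I)
    (w := N) (p := p) (by simpa using ⟨hmem.1, hN⟩) (by simpa using hmem.2) (by
      intro ξ hξ
      refine (DifferentiableAt.div (by fun_prop) (hD ξ) (hDne ξ ?_)).differentiableWithinAt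
      simpa using hξ.2)
  have hK : (fun ξ => (ξ + 1) / dslope φ p ξ / (ξ - p)) = lambertKernel z := by
    ext ξ
    rw [div_div, mul_comm (dslope φ p ξ), hmul]
    rfl
  rw [hK, dslope_same, hd'] at hc
  rw [hc]
  have h1 : p + 1 ≠ 0 := lambertSol_add_one_ne hτ
  have h2 := Complex.exp_ne_zero p
  rw [← hpz]
  field_simp

lemma continuousOn_lambertKernel_comp {τ : ℝ} (hτ : 0 < τ) {γ : ℝ → ℂ} {s : Set ℝ}
    (hγ : Continuous γ)
    (him : ∀ t ∈ s, (γ t).im ∈ Icc (-Real.pi) 0) (hne : ∀ t ∈ s, γ t ≠ lambertSol τ) :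
    ContinuousOn (fun t => lambertKernel (-cexp ((τ : ℂ) ^ 2 - 1)) (γ t)) s :=
  ContinuousOn.div (by fun_prop) (by fun_prop) fun t ht => mul_exp_ne hτ (him t ht) (hne t ht)

lemma integrableOn_lambertKernel {τ : ℝ} (hτ : 0 < τ) {y : ℝ} (hy : y = 0 ∨ y = -Real.pi) :
    IntegrableOn (fun t : ℝ => lambertKernel (-cexp ((τ : ℂ) ^ 2 - 1)) (t + y * I))
      (Ioi (-1)) := by
  have hpi := Real.pi_pos
  have hmem := (lambertSol_mem hτ).2
  have hcont : ContinuousOn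
      (fun t : ℝ => lambertKernel (-cexp ((τ : ℂ) ^ 2 - 1)) (t + y * I)) (Ici (-1)) :=
    continuousOn_lambertKernel_comp hτ (by fun_prop)
      (fun t _ => by rcases hy with h | h <;> simp [h, hpi.le])
      (fun t _ h => by
        have : (lambertSol τ).im = y := by rw [← h]; simp
        rcases hy with h | h <;> rw [this, h] at hmem
        · exact lt_irrefl _ hmem.2
        · exact lt_irrefl _ hmem.1)
  refine integrableOn_Ici_iff_integrableOn_Ioi (by finiteness) |>.mp <|
    (hcont.locallyIntegrableOn measurableSet_Ici).integrableOn_of_isBigO_atTop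
    (g := fun t : ℝ => Real.exp (-1 * t)) ?_
    ⟨Ioi 1, Ioi_mem_atTop 1, exp_neg_integrableOn_Ioi 1 one_pos⟩
  refine Asymptotics.IsBigO.of_bound 4 ?_
  filter_upwards [eventually_ge_atTop (1 : ℝ),
    eventually_ge_atTop (2 * ‖-cexp ((τ : ℂ) ^ 2 - 1)‖)] with t h1 h2
  have := norm_lambertKernel_le (z := -cexp ((τ : ℂ) ^ 2 - 1)) (ξ := t + y * I) (by simpa using h1)
    (by simpa using h2)
  simpa using this

/-- The right side of the rectangle is pushed to infinity; its contribution vanishes because the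
kernel is O(e^{-Re ξ}) uniformly in the strip. -/
theorem lambertW_eq {τ : ℝ} (hτ : 0 < τ) :
    lambertW (-cexp ((τ : ℂ) ^ 2 - 1)) = lambertSol τ := by
  set z := -cexp ((τ : ℂ) ^ 2 - 1) with hz
  have h1 := intervalIntegral_tendsto_integral_Ioi (-1)
    (integrableOn_lambertKernel hτ (Or.inr rfl)) tendsto_id
  have h2 := intervalIntegral_tendsto_integral_Ioi (-1)
    (integrableOn_lambertKernel hτ (Or.inl rfl)) tendsto_id
  have h3 : Tendsto (fun N : ℝ => ∫ y : ℝ in (-Real.pi)..0, lambertKernel z (N + y * I)) atTop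
      (𝓝 0) := by
    have hb : Tendsto (fun N : ℝ => 4 * Real.exp (-N) * |0 - (-Real.pi)|) atTop (𝓝 0) := by
      have := Real.tendsto_exp_neg_atTop_nhds_zero
      simpa using (this.const_mul 4).mul_const |0 - (-Real.pi)|
    refine squeeze_zero_norm' ?_ hb
    filter_upwards [eventually_ge_atTop (1 : ℝ), eventually_ge_atTop (2 * ‖z‖)] with N hN1 hN2
    refine intervalIntegral.norm_integral_le_of_norm_le_const fun y _ => ?_
    simpa using norm_lambertKernel_le (z := z) (ξ := N + y * I) (by simpa using hN1)
      (by simpa using hN2)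
  have h4 := (((h1.sub h2).add (h3.const_mul I)).sub_const
    (I * ∫ y : ℝ in (-Real.pi)..0, lambertKernel z (((-1 : ℝ) : ℂ) + y * I))).const_mul z
  have h5 : Tendsto (fun N : ℝ => z * rectInt (lambertKernel z) (-1 - Real.pi * I) N) atTop
      (𝓝 (2 * Real.pi * I * lambertSol τ)) := by
    refine tendsto_const_nhds.congr' ?_
    filter_upwards [eventually_gt_atTop (lambertSol τ).re] with N hN
    exact (rectInt_lambertKernel hτ hN).symm
  have h6 := tendsto_nhds_unique (h4.congr fun N => ?_) h5
  · have hpi : (Real.pi : ℂ) ≠ 0 := by exact_mod_cast Real.pi_ne_zero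
    have h7 : (∫ y : ℝ in (0 : ℝ)..(-Real.pi), lambertKernel z (-1 + y * I))
        = -∫ y : ℝ in (-Real.pi)..0, lambertKernel z (((-1 : ℝ) : ℂ) + y * I) := by
      rw [intervalIntegral.integral_symm]
      simp
    have h8 : ∀ t : ℝ, (t : ℂ) - Real.pi * I = t + (-Real.pi : ℝ) * I := fun t => by
      push_cast; ring
    rw [lambertW, h7]
    simp_rw [h8]
    simp only [ofReal_zero, zero_mul, add_zero, mul_zero] at h6
    rw [div_mul_eq_mul_div, div_eq_iff (by simp [hpi])]
    linear_combination h6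
  · simp [rectInt, ← hz]

/-! ### The parametrization of the curve -/

lemma theta_of_pos {τ : ℝ} (h : 0 < τ) : theta τ = graphPt (angle τ) := by
  rw [theta, if_pos h, thetaPlus, lambertW_eq h, lambertSol]
  linear_combination (-graphPt (angle τ)) * I_mul_I

@[simp] lemma theta_zero : theta 0 = 0 := by simp [theta]

lemma neg_conj_graphPt (a : ℝ) : -(starRingEnd ℂ) (graphPt a) = graphPt (-a) := by
  apply Complex.ext <;> simp

lemma theta_of_neg {τ : ℝ} (h : τ < 0) : theta τ = graphPt (-angle (-τ)) := by
  have h1 : 0 < -τ := by linarith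
  rw [theta, if_neg h.not_gt, if_neg h.ne, ← neg_conj_graphPt, ← theta_of_pos h1, theta, if_pos h1]

lemma theta_neg (τ : ℝ) : theta (-τ) = -(starRingEnd ℂ) (theta τ) := by
  rcases lt_trichotomy τ 0 with h | h | h
  · rw [theta_of_neg h, theta_of_pos (by linarith), neg_conj_graphPt, neg_neg]
  · simp [h]
  · rw [theta_of_pos h, theta_of_neg (by linarith), neg_conj_graphPt, neg_neg]

@[simp] lemma theta_neg_re (τ : ℝ) : (theta (-τ)).re = -(theta τ).re := by simp [theta_neg]

@[simp] lemma theta_neg_im (τ : ℝ) : (theta (-τ)).im = (theta τ).im := by simp [theta_neg]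

lemma graphPt_zero : graphPt 0 = 0 := by simp [graphPt]

lemma theta_eq_graphPt (τ : ℝ) : theta τ = graphPt (theta τ).re := by
  rcases lt_trichotomy τ 0 with h | h | h
  · rw [theta_of_neg h, graphPt_re]
  · simp [h, graphPt_zero]
  · rw [theta_of_pos h, graphPt_re]

lemma theta_im (τ : ℝ) : (theta τ).im = Real.log (Real.sinc (theta τ).re) := by
  conv_lhs => rw [theta_eq_graphPt, graphPt_im]

lemma theta_re_mem (τ : ℝ) : (theta τ).re ∈ Ioo (-Real.pi) Real.pi := by
  have := Real.pi_pos
  rcases lt_trichotomy τ 0 with h | h | h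
  · rw [theta_of_neg h, graphPt_re]
    have := angle_mem (-τ)
    exact ⟨by linarith [this.2], by linarith [this.1]⟩
  · simp [h, this]
  · rw [theta_of_pos h, graphPt_re]
    exact Ico_subset_strip (angle_mem τ)

lemma theta_re_pos {τ : ℝ} (h : 0 < τ) : 0 < (theta τ).re := by
  rw [theta_of_pos h, graphPt_re]
  exact angle_pos h

lemma theta_re_neg {τ : ℝ} (h : τ < 0) : (theta τ).re < 0 := by
  have := theta_re_pos (τ := -τ) (by linarith)
  rw [theta_neg_re] at this
  linarith

lemma level_theta (τ : ℝ) : level (theta τ).re = 1 - τ ^ 2 := by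
  rcases lt_trichotomy τ 0 with h | h | h
  · rw [theta_of_neg h, graphPt_re, level_neg, level_angle]
    ring
  · simp [h, level_zero]
  · rw [theta_of_pos h, graphPt_re, level_angle]

lemma theta_eq (τ : ℝ) : cexp (I * theta τ) - I * theta τ = 1 - (τ : ℂ) ^ 2 := by
  rw [theta_eq_graphPt, exp_sub_graphPt (theta_re_mem τ), level_theta]
  push_cast
  ring

/-- Reflection in the imaginary axis conjugates e^{iθ} - iθ, hence preserves equations with a real
right-hand side. This reduces negative τ to positive τ. -/
lemma conj_exp_sub (θ : ℂ) : cexp (I * -(starRingEnd ℂ) θ) - I * -(starRingEnd ℂ) θ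
    = (starRingEnd ℂ) (cexp (I * θ) - I * θ) := by
  rw [map_sub, ← exp_conj, map_mul, conj_I]
  ring_nf

/-- The equation sees only τ²; the sign condition selects the half of the curve. In this form the
lemma identifies local inverse branches with `theta`. -/
lemma eq_theta {τ : ℝ} {θ : ℂ} (h : θ.re ∈ Ioo (-Real.pi) Real.pi) (hs : 0 < τ * θ.re)
    (hθ : cexp (I * θ) - I * θ = 1 - (τ : ℂ) ^ 2) : θ = theta τ := by
  rcases lt_trichotomy τ 0 with h0 | h0 | h0
  · have hre : θ.re < 0 := by nlinarith
    have h1 : -(starRingEnd ℂ) θ = theta (-τ) := by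
      rw [theta_of_pos (by linarith : 0 < -τ)]
      refine eq_graphPt_angle ?_ ?_
      · simp only [neg_re, conj_re]
        exact ⟨by linarith, by linarith [h.1]⟩
      · rw [conj_exp_sub, hθ]
        simp
    rw [theta_neg, neg_inj] at h1
    exact (starRingEnd ℂ).injective h1
  · simp [h0] at hs
  · rw [theta_of_pos h0]
    exact eq_graphPt_angle ⟨pos_of_mul_pos_right hs h0.le, h.2⟩ hθ

lemma theta_injective : Function.Injective theta := by
  intro s t hst
  have h1 := theta_eq s
  rw [hst, theta_eq t] at h1
  have h2 : t ^ 2 = s ^ 2 := by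
    have : (t : ℂ) ^ 2 = (s : ℂ) ^ 2 := by linear_combination -h1
    exact_mod_cast this
  rcases sq_eq_sq_iff_eq_or_eq_neg.1 h2 with h | h
  · exact h.symm
  · rcases lt_trichotomy s 0 with h0 | h0 | h0
    · have h3 := theta_re_neg h0
      have h4 := theta_re_pos (τ := t) (by linarith)
      rw [hst] at h3
      linarith
    · rw [h, h0, neg_zero]
    · have h3 := theta_re_pos h0
      have h4 := theta_re_neg (τ := t) (by linarith)
      rw [hst] at h3
      linarith

lemma exists_theta_eq {a : ℝ} (ha : a ∈ Ioo (-Real.pi) Real.pi) : ∃ τ, theta τ = graphPt a := by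
  rcases eq_or_ne a 0 with h0 | h0
  · exact ⟨0, by simp [h0, graphPt_zero]⟩
  have hl := level_lt_one ha h0
  have hq : 0 < Real.sqrt (1 - level a) := Real.sqrt_pos.2 (by linarith)
  have hq2 : Real.sqrt (1 - level a) ^ 2 = 1 - level a := Real.sq_sqrt (by linarith)
  have key : ∀ τ : ℝ, τ ^ 2 = 1 - level a → 0 < τ * a → graphPt a = theta τ := fun τ h1 h2 => by
    refine eq_theta (by simpa using ha) (by simpa using h2) ?_
    rw [exp_sub_graphPt ha, ← ofReal_pow, h1]
    push_cast
    ring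
  rcases lt_or_gt_of_ne h0 with h | h
  · exact ⟨-Real.sqrt (1 - level a), (key _ (by rw [neg_sq, hq2]) (by nlinarith)).symm⟩
  · exact ⟨Real.sqrt (1 - level a), (key _ hq2 (by positivity)).symm⟩

lemma graphPt_mem_curveC {a : ℝ} (ha : a ∈ Ioo (-Real.pi) Real.pi) : graphPt a ∈ curveC := by
  rcases eq_or_ne a 0 with h0 | h0
  · exact Or.inl (by rw [h0, graphPt_zero])
  · exact Or.inr ⟨by simpa using ha, by simpa using h0, by rw [exp_sub_graphPt ha, ofReal_im]⟩

lemma bijOn_theta : BijOn theta univ curveC := by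
  refine ⟨fun τ _ => ?_, theta_injective.injOn, ?_⟩
  · rw [theta_eq_graphPt]
    exact graphPt_mem_curveC (theta_re_mem τ)
  · rintro θ (rfl | ⟨h1, h2, h3⟩)
    · exact ⟨0, mem_univ _, theta_zero⟩
    · obtain ⟨τ, hτ⟩ := exists_theta_eq h1
      exact ⟨τ, mem_univ _, hτ.trans (eq_graphPt h1 h2 h3).symm⟩

lemma omega_iff {τ : ℝ} (hτ : 0 < τ) (ϑ : ℂ) :
    (ϑ ∈ regionOmega ∧ cexp (I * ϑ) - I * ϑ = 1 - (τ : ℂ) ^ 2) ↔ ϑ = theta τ := by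
  constructor
  · rintro ⟨h1, h2⟩
    rw [theta_of_pos hτ]
    exact eq_graphPt_angle h1.1 h2
  · rintro rfl
    have := theta_re_pos hτ
    refine ⟨⟨⟨this, (theta_re_mem τ).2⟩, ?_⟩, theta_eq τ⟩
    rw [theta_im]
    exact log_sinc_neg (theta_re_mem τ) this.ne'

lemma regionR_iff {τ : ℝ} (hτ : 0 < τ) (w : ℂ) :
    (w ∈ regionR ∧ w * cexp w = -cexp ((τ : ℂ) ^ 2 - 1)) ↔
      w = lambertW (-cexp ((τ : ℂ) ^ 2 - 1)) := by
  rw [lambertW_eq hτ]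
  constructor
  · rintro ⟨h1, h2⟩
    exact eq_lambertSol h1.2 h2
  · rintro rfl
    exact ⟨lambertSol_mem hτ, lambertSol_mul_exp τ⟩

/-! ### Monotonicity along the curve -/

/-- The level is even, strictly decreasing in |Re θ|, and equal to 1 - τ² at θ(τ). -/
lemma theta_re_lt_theta_re {s t : ℝ} (hst : |s| < t) : |(theta s).re| < (theta t).re := by
  have ht : 0 < t := (abs_nonneg s).trans_lt hst
  have h1 : |(theta s).re| ∈ Ico 0 Real.pi := ⟨abs_nonneg _, abs_lt.2 (theta_re_mem s)⟩
  have h2 : (theta t).re ∈ Ico 0 Real.pi := ⟨(theta_re_pos ht).le, (theta_re_mem t).2⟩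
  refine (strictAntiOn_level.lt_iff_gt h2 h1).1 ?_
  have h3 : level |(theta s).re| = level (theta s).re := by
    rcases abs_choice (theta s).re with h | h <;> rw [h]
    exact level_neg _
  rw [h3, level_theta, level_theta]
  have := sq_lt_sq' (by linarith [abs_nonneg s]) hst
  rw [sq_abs] at this
  linarith

lemma abs_lt_of_theta_re {s t : ℝ} (ht : 0 < t) (h : |(theta s).re| < (theta t).re) : |s| < t := by
  by_contra! hc
  have habs : |(theta |s|).re| = |(theta s).re| := by
    rcases abs_choice s with h | h <;> rw [h]
    rw [theta_neg_re, abs_neg]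
  rcases eq_or_lt_of_le hc with h1 | h1
  · rw [h1, ← habs] at h
    exact (le_abs_self _).not_gt h
  · have := theta_re_lt_theta_re (s := t) (t := |s|) (by rwa [abs_of_pos ht])
    have h2 := (le_abs_self (theta t).re).trans_lt this
    rw [← habs] at h
    exact absurd (h2.trans_le (le_abs_self _)) h.not_gt

lemma log_sinc_abs (a : ℝ) : Real.log (Real.sinc |a|) = Real.log (Real.sinc a) := by
  rcases abs_choice a with h | h <;> rw [h]
  rw [Real.sinc_neg]

/-- The height of the graph decreases with the modulus of the real part. -/
lemma log_sinc_lt_log_sinc {a b : ℝ} (hb : b ∈ Ioo (-Real.pi) Real.pi) (hab : |a| < |b|) :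
    Real.log (Real.sinc b) < Real.log (Real.sinc a) := by
  have hb' : |b| ∈ Ico 0 Real.pi := ⟨abs_nonneg _, abs_lt.2 hb⟩
  rw [← log_sinc_abs a, ← log_sinc_abs b]
  exact Real.log_lt_log (sinc_pos (Ico_subset_strip hb'))
    (strictAntiOn_sinc ⟨abs_nonneg _, hab.trans hb'.2⟩ hb' hab)

/-! ### Smoothness -/

lemma hasDerivAt_exp_sub (θ : ℂ) :
    HasDerivAt (fun ϑ => cexp (I * ϑ) - I * ϑ) (I * (cexp (I * θ) - 1)) θ := by
  have h : HasDerivAt (fun ϑ => I * ϑ) I θ := by simpa using (hasDerivAt_id θ).const_mul I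
  exact (h.cexp.sub h).congr_deriv (by ring)

/-- Imaginary part of e^{iθ} = iθ + real number. It shows that i(e^{iθ} - 1), the derivative of
e^{iθ} - iθ, is nonzero on the curve away from the saddle. -/
lemma exp_theta_im (τ : ℝ) : (cexp (I * theta τ)).im = (theta τ).re := by
  have := congrArg Complex.im (theta_eq τ)
  have h : (1 - (τ : ℂ) ^ 2).im = 0 := by rw [← ofReal_pow, sub_im, ofReal_im]; simp
  rw [h, sub_im] at this
  simp only [mul_im, I_re, I_im, zero_mul, one_mul, zero_add] at this
  linarith

/-- Away from `0`, `θ` is locally a branch of an inverse function. -/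
lemma contDiffAt_theta_of_ne {τ₀ : ℝ} (h0 : τ₀ ≠ 0) : ContDiffAt ℝ ∞ theta τ₀ := by
  set f : ℂ → ℂ := fun ϑ => cexp (I * ϑ) - I * ϑ with hf
  have hre0 : (theta τ₀).re ≠ 0 := by
    rcases lt_or_gt_of_ne h0 with h | h
    · exact (theta_re_neg h).ne
    · exact (theta_re_pos h).ne'
  have hne : I * (cexp (I * theta τ₀) - 1) ≠ 0 := by
    refine mul_ne_zero I_ne_zero fun h => hre0 ?_
    have := congrArg Complex.im h
    rw [sub_im, exp_theta_im] at this
    simpa using this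
  have hcd : ContDiffAt ℂ ∞ f (theta τ₀) := by
    rw [hf]; fun_prop
  have hsd : HasStrictDerivAt f (I * (cexp (I * theta τ₀) - 1)) (theta τ₀) :=
    hcd.hasStrictDerivAt' (hasDerivAt_exp_sub _) (by simp)
  have hfe := hsd.hasStrictFDerivAt_equiv hne
  set σ := hfe.localInverse with hσ
  have hσc : ContDiffAt ℂ ∞ σ (f (theta τ₀)) := hcd.to_localInverse hfe.hasFDerivAt (by simp)
  have hσ0 : σ (f (theta τ₀)) = theta τ₀ := hfe.localInverse_apply_image
  have hσr : ∀ᶠ y in 𝓝 (f (theta τ₀)), f (σ y) = y := hfe.eventually_right_inverse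
  have hv : f (theta τ₀) = 1 - (τ₀ : ℂ) ^ 2 := theta_eq τ₀
  have hpath : ContDiff ℝ ∞ (fun τ : ℝ => (1 : ℂ) - (τ : ℂ) ^ 2) :=
    contDiff_const.sub (ofRealCLM.contDiff.pow 2)
  rw [hv] at hσc hσ0 hσr
  have hcomp : ContDiffAt ℝ ∞ (fun τ : ℝ => σ (1 - (τ : ℂ) ^ 2)) τ₀ :=
    ContDiffAt.comp τ₀ (hσc.restrict_scalars ℝ) hpath.contDiffAt
  refine hcomp.congr_of_eventuallyEq ?_
  have hcont : Tendsto (fun τ : ℝ => (σ (1 - (τ : ℂ) ^ 2)).re) (𝓝 τ₀) (𝓝 (theta τ₀).re) := by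
    have := continuous_re.continuousAt.comp hcomp.continuousAt
    rw [ContinuousAt, Function.comp_apply, hσ0] at this
    exact this
  have hpos : 0 < τ₀ * (theta τ₀).re := by
    rcases lt_or_gt_of_ne h0 with h | h
    · exact mul_pos_of_neg_of_neg h (theta_re_neg h)
    · exact mul_pos h (theta_re_pos h)
  -- The strip and the sign of τ Re σ are open conditions, so `eq_theta` identifies the branch σ
  -- with θ near τ₀.
  filter_upwards [hcont.eventually (isOpen_Ioo.mem_nhds (theta_re_mem τ₀)),
    (tendsto_id.mul hcont).eventually_const_lt hpos,
    (hpath.continuous.tendsto τ₀).eventually hσr] with τ h1 h2 h3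
  exact (eq_theta h1 h2 h3).symm

/-- At the saddle point `0`, `θ` is the inverse of a local square root of `1 - (e^{iθ} - iθ)`. -/
lemma theta_at_zero : ContDiffAt ℝ ∞ theta 0 ∧ 0 < (deriv theta 0).re := by
  set f : ℂ → ℂ := fun ϑ => 1 - (cexp (I * ϑ) - I * ϑ) with hf
  have hfd : Differentiable ℂ f := by rw [hf]; fun_prop
  have hf' : ∀ θ, HasDerivAt f (-(I * (cexp (I * θ) - 1))) θ := fun θ => by
    simpa using (hasDerivAt_exp_sub θ).const_sub 1
  -- The double zero at the saddle is divided out in two steps: f(θ) = θ² κ(θ).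
  set κ₁ := dslope f 0 with hκ₁
  set κ := dslope κ₁ 0 with hκ
  have dd : ∀ {h : ℂ → ℂ}, Differentiable ℂ h → Differentiable ℂ (dslope h 0) := fun {h} hh => by
    rw [← differentiableOn_univ] at hh ⊢
    exact (differentiableOn_dslope univ_mem).2 hh
  have hκ₁d : Differentiable ℂ κ₁ := dd hfd
  have hκd : Differentiable ℂ κ := dd hκ₁d
  have hf0 : f 0 = 0 := by simp [hf]
  have hκ₁0 : κ₁ 0 = 0 := by
    rw [hκ₁, dslope_same, (hf' 0).deriv]; simp
  have e1 : ∀ θ, θ * κ₁ θ = f θ := fun θ => by simpa [hf0] using sub_smul_dslope f 0 θ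
  have e2 : ∀ θ, θ * κ θ = κ₁ θ := fun θ => by simpa [hκ₁0] using sub_smul_dslope κ₁ 0 θ
  have e3 : ∀ θ, f θ = θ ^ 2 * κ θ := fun θ => by rw [← e1, ← e2]; ring
  -- The value κ(0) = f''(0)/2 comes from computing f''(0) twice, through θ²κ(θ) and through the
  -- exponential.
  have hκ0 : κ 0 = 1 / 2 := by
    have hd : ∀ θ, deriv f θ = 2 * θ * κ θ + θ ^ 2 * deriv κ θ := fun θ => by
      have h1 : HasDerivAt (fun θ => θ ^ 2 * κ θ) (2 * θ * κ θ + θ ^ 2 * deriv κ θ) θ := by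
        exact ((hasDerivAt_pow 2 θ).mul (hκd θ).hasDerivAt).congr_deriv (by simp)
      rw [funext e3, h1.deriv]
    have hd2 : HasDerivAt (deriv f) (2 * κ 0) 0 := by
      have h2 : HasDerivAt (fun θ => (2 * κ θ + θ * deriv κ θ)) _ 0 :=
        ((hκd 0).hasDerivAt.const_mul 2).add
          ((hasDerivAt_id (0 : ℂ)).mul ((hκd.deriv) 0).hasDerivAt)
      have h1 := (hasDerivAt_id (0 : ℂ)).mul h2
      have h3 : deriv f = id * fun θ => (2 * κ θ + θ * deriv κ θ) := by
        ext θ; rw [hd]; simp only [Pi.mul_apply, id]; ring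
      rw [h3]
      exact h1.congr_deriv (by simp)
    have hd3 : HasDerivAt (deriv f) 1 0 := by
      have h1 : deriv f = fun θ => -(I * (cexp (I * θ) - 1)) := funext fun θ => (hf' θ).deriv
      rw [h1]
      have h : HasDerivAt (fun ϑ => I * ϑ) I 0 := by
        simpa using (hasDerivAt_id (0 : ℂ)).const_mul I
      exact ((h.cexp.sub_const 1).const_mul I).neg.congr_deriv (by simp)
    have := hd2.unique hd3
    linear_combination this / 2
  -- the square root
  set q : ℂ → ℂ := fun θ => θ * κ θ ^ (1 / 2 : ℂ) with hq
  have hslit : κ 0 ∈ slitPlane := by rw [hκ0]; exact mem_slitPlane_iff.2 (Or.inl (by norm_num))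
  have hqa : AnalyticAt ℂ q 0 :=
    analyticAt_id.mul ((hκd.analyticAt 0).cpow analyticAt_const hslit)
  have hq0 : q 0 = 0 := by simp [hq]
  have hq2 : ∀ θ, q θ ^ 2 = f θ := fun θ => by
    rw [hq, e3, mul_pow, ← cpow_nat_mul]
    simp
  set r : ℂ := κ 0 ^ (1 / 2 : ℂ) with hr
  have hqd : HasDerivAt q r 0 := by
    have h1 := (hasDerivAt_id (0 : ℂ)).mul
      (((hκd.analyticAt 0).cpow (analyticAt_const (v := (1 / 2 : ℂ))) hslit).differentiableAt).hasDerivAt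
    exact h1.congr_deriv (by simp [hr])
  have hrval : r = (((1 / 2 : ℝ) ^ (1 / 2 : ℝ) : ℝ) : ℂ) := by
    rw [hr, hκ0, ofReal_cpow (by norm_num)]
    norm_num
  have hrpos : (0 : ℝ) < (1 / 2 : ℝ) ^ (1 / 2 : ℝ) := by positivity
  have hr0 : r ≠ 0 := by rw [hrval]; exact_mod_cast hrpos.ne'
  have hcd : ContDiffAt ℂ ∞ q 0 := hqa.contDiffAt
  have hsd : HasStrictDerivAt q r 0 := hcd.hasStrictDerivAt' hqd (by simp)
  have hfe := hsd.hasStrictFDerivAt_equiv hr0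
  set σ := hfe.localInverse with hσ
  have hσc : ContDiffAt ℂ ∞ σ (q 0) := hcd.to_localInverse hfe.hasFDerivAt (by simp)
  have hσ0 : σ (q 0) = 0 := hfe.localInverse_apply_image
  have hσr : ∀ᶠ y in 𝓝 (q 0), q (σ y) = y := hfe.eventually_right_inverse
  have hσd : HasDerivAt σ r⁻¹ (q 0) := (hsd.to_localInverse hr0).hasDerivAt
  rw [hq0] at hσc hσ0 hσr hσd
  have hcomp : ContDiffAt ℝ ∞ (fun τ : ℝ => σ (τ : ℂ)) 0 :=
    ContDiffAt.comp (0 : ℝ) (g := σ) (f := fun τ : ℝ => (τ : ℂ))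
      (by rw [ofReal_zero]; exact hσc.restrict_scalars ℝ) ofRealCLM.contDiff.contDiffAt
  have hderiv : HasDerivAt (fun τ : ℝ => σ (τ : ℂ)) r⁻¹ 0 := by
    have := HasDerivAt.comp_ofReal (e := σ) (e' := r⁻¹) (z := 0) (by simpa using hσd)
    exact this
  have hrinv : r⁻¹.re = ((1 / 2 : ℝ) ^ (1 / 2 : ℝ))⁻¹ := by
    rw [hrval, ← ofReal_inv, ofReal_re]
  -- The local inverse has a positive real derivative at 0, so Re σ(τ) has the sign of τ: this fixes
  -- which of the two square roots parametrizes the curve.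
  have hslope : ∀ᶠ τ : ℝ in 𝓝[≠] 0, 0 < τ * (σ (τ : ℂ)).re := by
    have h1 := hderiv.tendsto_slope
    have h2 := (continuous_re.tendsto _).comp h1
    rw [hrinv] at h2
    filter_upwards [h2.eventually_const_lt (inv_pos.2 hrpos), self_mem_nhdsWithin] with τ h3 h4
    simp only [Function.comp_apply, slope_def_module, sub_zero, ofReal_zero, hσ0, real_smul,
      re_ofReal_mul] at h3
    have h5 : 0 < τ ^ 2 := by have : τ ≠ 0 := h4; positivity
    have h6 := mul_pos h5 h3
    have h7 : τ ≠ 0 := h4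
    have h8 : τ ^ 2 * (τ⁻¹ * (σ (τ : ℂ)).re) = τ * (σ (τ : ℂ)).re := by field_simp
    rwa [h8] at h6
  have hcont : Tendsto (fun τ : ℝ => (σ (τ : ℂ)).re) (𝓝 0) (𝓝 0) := by
    have := continuous_re.continuousAt.comp hcomp.continuousAt
    rw [ContinuousAt, Function.comp_apply, ofReal_zero, hσ0, zero_re] at this
    exact this
  have hpi := Real.pi_pos
  have heq : theta =ᶠ[𝓝 0] fun τ : ℝ => σ (τ : ℂ) := by
    rw [eventually_nhdsWithin_iff] at hslope
    have hro : Tendsto (fun τ : ℝ => (τ : ℂ)) (𝓝 0) (𝓝 0) := by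
      simpa using continuous_ofReal.tendsto (0 : ℝ)
    filter_upwards [hcont.eventually (isOpen_Ioo.mem_nhds
      (show (0 : ℝ) ∈ Ioo (-Real.pi) Real.pi from ⟨by linarith, hpi⟩)), hslope,
      hro.eventually hσr] with τ h1 h2 h3
    rcases eq_or_ne τ 0 with h | h
    · rw [h, theta_zero, ofReal_zero, hσ0]
    · refine (eq_theta h1 (h2 h) ?_).symm
      have := hq2 (σ τ)
      rw [h3] at this
      rw [this, hf]
      ring
  refine ⟨hcomp.congr_of_eventuallyEq heq, ?_⟩
  rw [heq.deriv_eq, hderiv.deriv, hrinv]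
  exact inv_pos.2 hrpos

lemma contDiff_theta : ContDiff ℝ ∞ theta := by
  refine contDiff_iff_contDiffAt.2 fun τ => ?_
  rcases eq_or_ne τ 0 with h | h
  · rw [h]; exact theta_at_zero.1
  · exact contDiffAt_theta_of_ne h

lemma hasDerivAt_theta (τ : ℝ) : HasDerivAt theta (deriv theta τ) τ :=
  (contDiff_theta.differentiable (by simp) τ).hasDerivAt

lemma continuous_deriv_theta : Continuous (deriv theta) :=
  contDiff_theta.continuous_deriv (by simp)

/-- With u = e^{iθ} - 1, differentiating the equation gives i u θ' = -2τ, hence |u|² Re θ' = 2τ Im u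
= 2τ Re θ > 0 for τ ≠ 0. Beyond regularity, the sign fixes the side on which the curve passes a
pole. -/
lemma deriv_theta_re_pos (τ : ℝ) : 0 < (deriv theta τ).re := by
  rcases eq_or_ne τ 0 with h | h0
  · rw [h]; exact theta_at_zero.2
  have h1 : HasDerivAt (fun τ : ℝ => cexp (I * theta τ) - I * theta τ)
      (I * (cexp (I * theta τ) - 1) * deriv theta τ) τ :=
    (hasDerivAt_exp_sub (theta τ)).comp τ (hasDerivAt_theta τ)
  have h2 : HasDerivAt (fun τ : ℝ => 1 - (τ : ℂ) ^ 2) (-(2 * (τ : ℂ))) τ := by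
    simpa using ((hasDerivAt_id τ).ofReal_comp.pow 2).const_sub 1
  rw [funext theta_eq] at h1
  have h3 := h1.unique h2
  set u := cexp (I * theta τ) - 1 with hu
  have hui : u.im = (theta τ).re := by rw [hu, sub_im, exp_theta_im]; simp
  have hpos : 0 < τ * (theta τ).re := by
    rcases lt_or_gt_of_ne h0 with h | h
    · exact mul_pos_of_neg_of_neg h (theta_re_neg h)
    · exact mul_pos h (theta_re_pos h)
  have hun : 0 < normSq u := by
    rw [normSq_pos]
    intro h
    rw [h] at hui
    simp [← hui] at hpos
  have h4 : deriv theta τ * normSq u = I * (2 * τ) * (starRingEnd ℂ) u := by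
    rw [← mul_conj]
    linear_combination (-I * (starRingEnd ℂ) u) * h3 + deriv theta τ * u * (starRingEnd ℂ) u * I_mul_I
  have h5 := congrArg Complex.re h4
  have h6 : (I * (2 * τ) * (starRingEnd ℂ) u).re = 2 * τ * u.im := by
    simp
  rw [re_mul_ofReal, h6, hui] at h5
  exact pos_of_mul_pos_left (by rw [h5]; linarith) hun.le

/-! ### Partial fractions -/

lemma analyticAt_dslope_same {h : ℂ → ℂ} {a : ℂ} (hh : AnalyticAt ℂ h a) :
    AnalyticAt ℂ (dslope h a) a := by
  obtain ⟨p, hp⟩ := hh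
  exact ⟨_, hp.has_fpower_series_dslope_fslope⟩

/-- The principal part of a function with a pole: a simple fraction plus a derivative. -/
lemma exists_principalPart (a : ℂ) (N : ℕ) : ∀ h : ℂ → ℂ, AnalyticAt ℂ h a →
    ∃ (c : ℂ) (D k : ℂ → ℂ), AnalyticAt ℂ k a ∧ (∀ z, z ≠ a → DifferentiableAt ℂ D z) ∧
      (N ≤ 1 → D = 0) ∧
      ∀ᶠ z in 𝓝[≠] a, h z / (z - a) ^ N = c / (z - a) + deriv D z + k z := by
  induction N with
  | zero =>
    intro h hh
    exact ⟨0, 0, h, hh, fun z _ => differentiableAt_const _, fun _ => rfl, by simp⟩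
  | succ N ih =>
    intro h hh
    have hstep : ∀ z, h z = h a + (z - a) * dslope h a z := fun z => by
      have := sub_smul_dslope h a z
      rw [smul_eq_mul] at this
      rw [this]; ring
    -- A simple pole needs no derivative term. This is what later keeps the primitive E regular
    -- across simple poles.
    rcases Nat.eq_zero_or_pos N with rfl | hN
    · refine ⟨h a, 0, dslope h a, analyticAt_dslope_same hh, fun z _ => differentiableAt_const _,
        fun _ => rfl, ?_⟩
      filter_upwards [self_mem_nhdsWithin] with z hz
      have hz' : z - a ≠ 0 := sub_ne_zero.2 hz
      rw [hstep z]
      have : deriv (0 : ℂ → ℂ) z = 0 := deriv_const _ _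
      rw [this]
      field_simp
      ring
    -- From order two on, the leading term h(a)/(z - a)^{N+1} has a single-valued primitive; the
    -- remainder has lower order.
    · obtain ⟨c, D, k, hk, hD, -, hev⟩ := ih _ (analyticAt_dslope_same hh)
      have hN0 : (N : ℂ) ≠ 0 := by exact_mod_cast hN.ne'
      have hD0 : ∀ z, z ≠ a → HasDerivAt (fun z => -(h a / N) * ((z - a) ^ N)⁻¹)
          (h a / (z - a) ^ (N + 1)) z := fun z hz => by
        have hz' : z - a ≠ 0 := sub_ne_zero.2 hz
        have h1 : HasDerivAt (fun z => (z - a) ^ N) (N * (z - a) ^ (N - 1) * 1) z :=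
          ((hasDerivAt_id z).sub_const a).pow N
        refine ((h1.inv (pow_ne_zero _ hz')).const_mul (-(h a / N))).congr_deriv ?_
        obtain ⟨M, rfl⟩ := Nat.exists_eq_add_of_lt hN
        simp only [zero_add, Nat.add_sub_cancel] at hN0 ⊢
        field_simp
        ring
      refine ⟨c, fun z => -(h a / N) * ((z - a) ^ N)⁻¹ + D z, k, hk,
        fun z hz => (hD0 z hz).differentiableAt.add (hD z hz), fun hN1 => by omega, ?_⟩
      filter_upwards [hev, self_mem_nhdsWithin] with z hz1 hz
      have hz' : z - a ≠ 0 := sub_ne_zero.2 hz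
      have hd : deriv (fun z => -(h a / N) * ((z - a) ^ N)⁻¹ + D z) z
          = h a / (z - a) ^ (N + 1) + deriv D z :=
        ((hD0 z hz).add (hD z hz).hasDerivAt).deriv
      have e1 : h z / (z - a) ^ (N + 1) = h a / (z - a) ^ (N + 1) + dslope h a z / (z - a) ^ N := by
        rw [hstep z]
        field_simp
        ring
      rw [hd, e1, hz1]
      ring

/-- A function on a disc with finitely many poles is a sum of simple fractions and a derivative. -/
theorem exists_partialFraction {R : ℝ} (N : ℂ → ℕ) (Z : Finset ℂ) : ∀ G : ℂ → ℂ,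
    DifferentiableOn ℂ G (Metric.ball 0 R \ Z) →
    (∀ a ∈ Z, ∃ h : ℂ → ℂ, AnalyticAt ℂ h a ∧ ∀ᶠ z in 𝓝[≠] a, G z = h z / (z - a) ^ N a) →
    ∃ (c : ℂ → ℂ) (E : ℂ → ℂ),
      (∀ z ∈ Metric.ball (0 : ℂ) R, (z ∈ Z → N z ≤ 1) → DifferentiableAt ℂ E z) ∧
      ∀ z ∈ Metric.ball (0 : ℂ) R \ Z, HasDerivAt E (G z - ∑ a ∈ Z, c a / (z - a)) z := by
  classical
  induction Z using Finset.induction_on with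
  | empty =>
    intro G hG _
    obtain ⟨E, hE⟩ := DifferentiableOn.isExactOn_ball (by simpa using hG)
    exact ⟨0, E, fun z hz _ => (hE z hz).differentiableAt, fun z hz => by simpa using hE z hz.1⟩
  | insert a Z haZ ih =>
    intro G hG hpole
    obtain ⟨h, hh, hGh⟩ := hpole a (Finset.mem_insert_self a Z)
    obtain ⟨c₀, D, k, hk, hD, hD1, hev⟩ := exists_principalPart a (N a) h hh
    have hDa : ∀ z, z ≠ a → AnalyticAt ℂ D z := fun z hz =>
      DifferentiableOn.analyticAt (s := {a}ᶜ)
        (fun y hy => (hD y hy).differentiableWithinAt) (isOpen_compl_singleton.mem_nhds hz)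
    set T : ℂ → ℂ := fun z => c₀ / (z - a) + deriv D z with hT
    have hTa : ∀ z, z ≠ a → AnalyticAt ℂ T z := fun z hz =>
      (analyticAt_const.div (analyticAt_id.sub analyticAt_const) (sub_ne_zero.2 hz)).add
        (hDa z hz).deriv
    -- Subtract the principal part at a and fill in the value k(a), making the function holomorphic
    -- at a; the induction then runs over the remaining poles.
    set G₂ : ℂ → ℂ := Function.update (fun z => G z - T z) a (k a) with hG₂
    have hG₂ne : ∀ z, z ≠ a → G₂ z = G z - T z := fun z hz => Function.update_of_ne hz _ _
    have hG₂ev : ∀ z, z ≠ a → G₂ =ᶠ[𝓝 z] fun z => G z - T z := fun z hz => by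
      filter_upwards [isOpen_compl_singleton.mem_nhds hz] with y hy using hG₂ne y hy
    have hG₂a : G₂ =ᶠ[𝓝 a] k := by
      have : ∀ᶠ z in 𝓝[≠] a, G₂ z = k z := by
        filter_upwards [hGh, hev, self_mem_nhdsWithin] with z h1 h2 h3
        rw [hG₂ne z h3, h1, h2, hT]
        ring
      rw [eventually_nhdsWithin_iff] at this
      filter_upwards [this] with z hz
      rcases eq_or_ne z a with rfl | h
      · exact Function.update_self _ _ _
      · exact hz h
    have hopen : IsOpen (Metric.ball (0 : ℂ) R \ (insert a Z : Finset ℂ)) :=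
      Metric.isOpen_ball.sdiff (Finset.finite_toSet _).isClosed
    obtain ⟨c, E, hE1, hE2⟩ := ih G₂ (by
      intro z hz
      rcases eq_or_ne z a with rfl | hza
      · exact (hk.differentiableAt.congr_of_eventuallyEq hG₂a).differentiableWithinAt
      · have hz' : z ∈ Metric.ball (0 : ℂ) R \ (insert a Z : Finset ℂ) :=
          ⟨hz.1, by simpa [hza] using hz.2⟩
        exact (((hG.differentiableAt (hopen.mem_nhds hz')).sub
          (hTa z hza).differentiableAt).congr_of_eventuallyEq (hG₂ev z hza)).differentiableWithinAt)
      (by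
        intro b hb
        have hba : b ≠ a := fun h => haZ (h ▸ hb)
        obtain ⟨hb', hhb, hev'⟩ := hpole b (Finset.mem_insert_of_mem hb)
        refine ⟨fun z => hb' z - (z - b) ^ N b * T z, hhb.sub
          (((analyticAt_id.sub analyticAt_const).pow _).mul (hTa b hba)), ?_⟩
        filter_upwards [hev', nhdsWithin_le_nhds (hG₂ev b hba), self_mem_nhdsWithin] with z h1 h2 h3
        have : z - b ≠ 0 := sub_ne_zero.2 h3
        rw [h2, h1]
        field_simp)
    refine ⟨fun b => if b = a then c₀ else c b, fun z => E z + D z, fun z hz hN => ?_,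
      fun z hz => ?_⟩
    · rcases eq_or_ne z a with rfl | hza
      · rw [hD1 (hN (Finset.mem_insert_self _ _))]
        simpa using hE1 z hz fun h => absurd h haZ
      · exact (hE1 z hz fun h => hN (Finset.mem_insert_of_mem h)).add (hD z hza)
    · have hza : z ≠ a := fun h => hz.2 (by simp [h])
      have hzZ : z ∉ (Z : Set ℂ) := fun h => hz.2 (by
        rw [Finset.coe_insert]; exact Or.inr h)
      refine ((hE2 z ⟨hz.1, hzZ⟩).add (hD z hza).hasDerivAt).congr_deriv ?_
      rw [Finset.sum_insert haZ, hG₂ne z hza, hT]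
      simp only [if_true]
      have : ∑ b ∈ Z, (if b = a then c₀ else c b) / (z - b) = ∑ b ∈ Z, c b / (z - b) :=
        Finset.sum_congr rfl fun b hb => by
          rw [if_neg (fun h : b = a => haZ (h ▸ hb))]
      rw [this]
      ring

/-! ### Residues -/

/-- If `f` is `P z / (z - p)` up to a derivative, its integral over small circles is
`2πi P(p)`. -/
lemma eventually_circleIntegral_eq {f P K : ℂ → ℂ} {p : ℂ}
    (hf : ∀ᶠ z in 𝓝[≠] p, DifferentiableAt ℂ f z) (hP : AnalyticAt ℂ P p)
    (hK : ∀ᶠ z in 𝓝[≠] p, HasDerivAt K (f z - (z - p)⁻¹ * P z) z) :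
    ∀ᶠ r in 𝓝[>] (0 : ℝ), ∮ z in C(p, r), f z = 2 * Real.pi * I * P p := by
  have hall := (hf.and hK).and (hP.eventually_analyticAt.filter_mono
    (nhdsWithin_le_nhds (s := {p}ᶜ)))
  rw [eventually_nhdsWithin_iff, Metric.eventually_nhds_iff_ball] at hall
  obtain ⟨δ, hδ, hball⟩ := hall
  filter_upwards [Ioo_mem_nhdsGT hδ] with r hr
  have hsub : ∀ z ∈ Metric.closedBall p r, z ∈ Metric.ball p δ :=
    Metric.closedBall_subset_ball hr.2
  have hsph : ∀ z ∈ Metric.sphere p r, z ≠ p := fun z hz => Metric.ne_of_mem_sphere hz hr.1.ne'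
  have hPd : DifferentiableOn ℂ P (Metric.closedBall p r) := fun z hz => by
    rcases eq_or_ne z p with rfl | h
    · exact hP.differentiableAt.differentiableWithinAt
    · exact (hball z (hsub z hz) h).2.differentiableAt.differentiableWithinAt
  have h1 : ∮ z in C(p, r), (z - p)⁻¹ * P z = 2 * Real.pi * I * P p :=
    DifferentiableOn.circleIntegral_sub_inv_smul hPd (Metric.mem_ball_self hr.1)
  have h2 : ∮ z in C(p, r), (f z - (z - p)⁻¹ * P z) = 0 :=
    circleIntegral.integral_eq_zero_of_hasDerivWithinAt hr.1.le fun z hz =>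
      (hball z (hsub z (Metric.sphere_subset_closedBall hz)) (hsph z hz)).1.2.hasDerivWithinAt
  have hi1 : CircleIntegrable f p r := ContinuousOn.circleIntegrable hr.1.le fun z hz =>
    (hball z (hsub z (Metric.sphere_subset_closedBall hz)) (hsph z
      hz)).1.1.continuousAt.continuousWithinAt
  have hi2 : CircleIntegrable (fun z => (z - p)⁻¹ * P z) p r :=
    ContinuousOn.circleIntegrable hr.1.le
      ((ContinuousOn.inv₀ (by fun_prop) fun z hz => sub_ne_zero.2 (hsph z hz)).mul
        (hPd.continuousOn.mono Metric.sphere_subset_closedBall))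
  rw [circleIntegral.integral_sub hi1 hi2, h1, sub_eq_zero] at h2
  exact h2

/-- The circle integrals are eventually constant, so the limit defining `residue` is that constant.
-/
lemma residue_eq {f P K : ℂ → ℂ} {p : ℂ}
    (hf : ∀ᶠ z in 𝓝[≠] p, DifferentiableAt ℂ f z) (hP : AnalyticAt ℂ P p)
    (hK : ∀ᶠ z in 𝓝[≠] p, HasDerivAt K (f z - (z - p)⁻¹ * P z) z) :
    residue f p = P p := by
  refine Tendsto.limUnder_eq (tendsto_const_nhds.congr' ?_)
  filter_upwards [eventually_circleIntegral_eq hf hP hK] with r hr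
  have hpi : (Real.pi : ℂ) ≠ 0 := by exact_mod_cast Real.pi_ne_zero
  rw [hr]
  field_simp

section PartialFraction

variable {R : ℝ} {Z : Finset ℂ} {G c E : ℂ → ℂ}

lemma eventually_mem_diff {a : ℂ} (ha : a ∈ Metric.ball (0 : ℂ) R) :
    ∀ᶠ z in 𝓝[≠] a, z ∈ Metric.ball (0 : ℂ) R \ (Z : Set ℂ) := by
  have h1 : ∀ᶠ z in 𝓝[≠] a, z ∈ Metric.ball (0 : ℂ) R :=
    nhdsWithin_le_nhds (Metric.isOpen_ball.mem_nhds ha)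
  have h2 : ((Z : Set ℂ) \ {a})ᶜ ∈ 𝓝 a :=
    ((Finset.finite_toSet Z).sdiff.isClosed.isOpen_compl).mem_nhds fun h => h.2 rfl
  filter_upwards [h1, nhdsWithin_le_nhds h2, self_mem_nhdsWithin] with z hz1 hz2 hz3
  exact ⟨hz1, fun h => hz2 ⟨h, hz3⟩⟩

/-- Near one of the poles, only that simple fraction is singular. -/
lemma exists_local_decomposition
    (hE : ∀ z ∈ Metric.ball (0 : ℂ) R \ Z, HasDerivAt E (G z - ∑ a ∈ Z, c a / (z - a)) z)
    {a : ℂ} (ha : a ∈ Metric.ball (0 : ℂ) R) (haZ : a ∈ Z) :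
    ∃ P : ℂ → ℂ, AnalyticAt ℂ P a ∧ P a = c a ∧
      ∀ᶠ z in 𝓝[≠] a, HasDerivAt E (G z - (z - a)⁻¹ * P z) z := by
  classical
  refine ⟨fun z => c a + (z - a) * ∑ b ∈ Z.erase a, c b / (z - b), ?_, by simp, ?_⟩
  · refine analyticAt_const.add ((analyticAt_id.sub analyticAt_const).mul ?_)
    refine Finset.analyticAt_fun_sum _ fun b hb => ?_
    exact analyticAt_const.div (analyticAt_id.sub analyticAt_const)
      (sub_ne_zero.2 (Finset.ne_of_mem_erase hb).symm)
  · filter_upwards [eventually_mem_diff (Z := Z) ha, self_mem_nhdsWithin] with z hz hza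
    refine (hE z hz).congr_deriv ?_
    have : z - a ≠ 0 := sub_ne_zero.2 hza
    rw [← Finset.add_sum_erase Z _ haZ]
    field_simp

/-- Change of variable w = e^{iθ}: since w - w₀ = (θ - θ₀) · `dslope e θ₀ θ`, the numerator c
becomes w₀c/(i w₀) = -ic, while E pulls back to a primitive of the rest. -/
lemma residue_exp_mul
    (hG : DifferentiableOn ℂ G (Metric.ball 0 R \ Z))
    (hE : ∀ z ∈ Metric.ball (0 : ℂ) R \ Z, HasDerivAt E (G z - ∑ a ∈ Z, c a / (z - a)) z)
    {θ₀ : ℂ} (ha : cexp (I * θ₀) ∈ Metric.ball (0 : ℂ) R) (haZ : cexp (I * θ₀) ∈ Z) :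
    residue (fun θ => cexp (I * θ) * G (cexp (I * θ))) θ₀ = -I * c (cexp (I * θ₀)) := by
  obtain ⟨P, hP, hPa, hev⟩ := exists_local_decomposition hE ha haZ
  set e : ℂ → ℂ := fun θ => cexp (I * θ) with he
  have hed : ∀ θ, HasDerivAt e (e θ * I) θ := fun θ => by
    have h : HasDerivAt (fun ϑ => I * ϑ) I θ := by simpa using (hasDerivAt_id θ).const_mul I
    exact h.cexp
  have hea : AnalyticAt ℂ e θ₀ := by
    rw [he]; fun_prop
  have hne : e θ₀ * I ≠ 0 := mul_ne_zero (Complex.exp_ne_zero _) I_ne_zero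
  have htend : Tendsto e (𝓝[≠] θ₀) (𝓝[≠] (e θ₀)) := (hed θ₀).tendsto_nhdsNE hne
  have hq0 : dslope e θ₀ θ₀ = e θ₀ * I := by rw [dslope_same, (hed θ₀).deriv]
  have hopen : IsOpen (Metric.ball (0 : ℂ) R \ (Z : Set ℂ)) :=
    Metric.isOpen_ball.sdiff (Finset.finite_toSet _).isClosed
  have hr := residue_eq (f := fun θ => e θ * G (e θ)) (p := θ₀)
    (P := fun θ => e θ * P (e θ) / dslope e θ₀ θ) (K := fun θ => -I * E (e θ)) ?_ ?_ ?_
  · refine hr.trans ?_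
    rw [hq0, hPa]
    have h0 : e θ₀ ≠ 0 := Complex.exp_ne_zero _
    have hI := I_ne_zero
    rw [show cexp (I * θ₀) = e θ₀ from rfl]
    field_simp
    rw [I_sq]
    ring
  · filter_upwards [htend.eventually (eventually_mem_diff (Z := Z) ha)] with θ hθ
    exact (hed θ).differentiableAt.mul ((hG.differentiableAt (hopen.mem_nhds hθ)).comp θ
      (hed θ).differentiableAt)
  · refine (hea.mul (AnalyticAt.fun_comp hP hea)).div (analyticAt_dslope_same hea) (by rwa [hq0])
  · filter_upwards [htend.eventually hev, htend.eventually self_mem_nhdsWithin,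
      self_mem_nhdsWithin] with θ h1 h2 h3
    refine ((h1.comp θ (hed θ)).const_mul (-I)).congr_deriv ?_
    have h4 : e θ - e θ₀ ≠ 0 := sub_ne_zero.2 h2
    have h5 : θ - θ₀ ≠ 0 := sub_ne_zero.2 h3
    have h6 : dslope e θ₀ θ = (e θ - e θ₀) / (θ - θ₀) := by
      rw [dslope_of_ne _ h3, slope_def_field]
    rw [h6, show cexp (I * θ₀) = e θ₀ from rfl]
    field_simp
    ring_nf
    simp only [I_sq]
    ring

/-- Both sides, up to 2πi, are the integral of G over one small circle: by the partial fraction, and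
by Cauchy's formula for derivatives. -/
lemma coeff_eq_iteratedDeriv {Φ : ℂ → ℂ} {n : ℕ} (hΦ : AnalyticAt ℂ Φ 0)
    (hG : DifferentiableOn ℂ G (Metric.ball 0 R \ Z))
    (hGΦ : ∀ z, G z = Φ z / z ^ (n + 1))
    (hE : ∀ z ∈ Metric.ball (0 : ℂ) R \ Z, HasDerivAt E (G z - ∑ a ∈ Z, c a / (z - a)) z)
    (hR : 0 < R) (h0 : 0 ∈ Z) : c 0 = iteratedDeriv n Φ 0 / n.factorial := by
  have hb : (0 : ℂ) ∈ Metric.ball (0 : ℂ) R := Metric.mem_ball_self hR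
  obtain ⟨P, hP, hPa, hev⟩ := exists_local_decomposition hE hb h0
  have hopen : IsOpen (Metric.ball (0 : ℂ) R \ (Z : Set ℂ)) :=
    Metric.isOpen_ball.sdiff (Finset.finite_toSet _).isClosed
  have h1 := eventually_circleIntegral_eq (f := G) (by
    filter_upwards [eventually_mem_diff (Z := Z) hb] with z hz
    exact hG.differentiableAt (hopen.mem_nhds hz)) hP hev
  have h2 := hΦ.eventually_analyticAt
  rw [Metric.eventually_nhds_iff_ball] at h2
  obtain ⟨δ, hδ, hball⟩ := h2
  obtain ⟨r, hr1, hr2⟩ := (h1.and (Ioo_mem_nhdsGT hδ)).exists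
  have h3 := DifferentiableOn.circleIntegral_one_div_sub_center_pow_smul (f := Φ) (c := 0) hr2.1 n
    fun z hz => (hball z (Metric.closedBall_subset_ball hr2.2 hz)).differentiableAt.differentiableWithinAt
  have h4 : ∮ z in C((0 : ℂ), r), G z = ∮ z in C(0, r), (1 / (z - 0) ^ (n + 1)) • Φ z := by
    congr 1
    ext z
    rw [hGΦ, sub_zero, smul_eq_mul]
    ring
  rw [h4, h3, hPa, smul_eq_mul] at hr1
  have hpi : (Real.pi : ℂ) ≠ 0 := by exact_mod_cast Real.pi_ne_zero
  have hI := I_ne_zero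
  have hn : (n.factorial : ℂ) ≠ 0 := by exact_mod_cast n.factorial_ne_zero
  have h5 : 2 * Real.pi * I * (iteratedDeriv n Φ 0 / n.factorial) = 2 * Real.pi * I * c 0 := by
    rw [← hr1]; ring
  exact (mul_left_cancel₀ (by simp [hpi]) h5).symm

end PartialFraction

lemma iteratedDeriv_comp_mul_left (f : ℂ → ℂ) (c : ℂ) (n : ℕ) :
    iteratedDeriv n (fun z => f (c * z)) = fun z => c ^ n * iteratedDeriv n f (c * z) := by
  induction n with
  | zero => simp
  | succ n ih =>
    rw [iteratedDeriv_succ, ih, iteratedDeriv_succ]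
    ext z
    rw [deriv_const_mul_field, deriv_comp_mul_left c (iteratedDeriv n f) z, smul_eq_mul]
    ring

/-! ### Principal values with excised neighbourhoods -/

/-- The interval `[-T, T]` without the `ε`-neighbourhoods of the points of `P`. -/
def excised (P : Set ℝ) (T ε : ℝ) : Set ℝ := {τ | τ ∈ Icc (-T) T ∧ ∀ p ∈ P, ε ≤ |τ - p|}

section PV

variable {P : Set ℝ} {T : ℝ} {f g : ℝ → ℂ} {v u : ℂ}

lemma isClosed_excised (P : Set ℝ) (T ε : ℝ) : IsClosed (excised P T ε) := by
  have : excised P T ε = Icc (-T) T ∩ ⋂ p ∈ P, {τ | ε ≤ |τ - p|} := by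
    ext τ; simp [excised]
  rw [this]
  exact isClosed_Icc.inter (isClosed_biInter fun p _ => isClosed_le (by fun_prop) (by fun_prop))

lemma isCompact_excised (P : Set ℝ) (T ε : ℝ) : IsCompact (excised P T ε) :=
  isCompact_Icc.of_isClosed_subset (isClosed_excised P T ε) fun _ h => h.1

lemma excised_subset {ε : ℝ} (hε : 0 < ε) : excised P T ε ⊆ Icc (-T) T \ P := fun τ hτ =>
  ⟨hτ.1, fun h => by simpa using hε.trans_le (hτ.2 τ h)⟩

lemma integrableOn_excised (hf : ContinuousOn f (Icc (-T) T \ P)) {ε : ℝ} (hε : 0 < ε) :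
    IntegrableOn f (excised P T ε) :=
  (hf.mono (excised_subset hε)).integrableOn_compact (isCompact_excised P T ε)

lemma hasPVIntegralUpTo_iff :
    HasPVIntegralUpTo f P T v ↔ Tendsto (fun ε => ∫ τ in excised P T ε, f τ) (𝓝[>] 0) (𝓝 v) :=
  Iff.rfl

lemma HasPVIntegralUpTo.congr (h : HasPVIntegralUpTo f P T v) (hfg : EqOn g f (Icc (-T) T \ P)) :
    HasPVIntegralUpTo g P T v := by
  rw [hasPVIntegralUpTo_iff] at h ⊢
  refine h.congr' ?_
  filter_upwards [self_mem_nhdsWithin] with ε hε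
  exact setIntegral_congr_fun (isClosed_excised P T ε).measurableSet fun τ hτ =>
    (hfg (excised_subset hε hτ)).symm

lemma HasPVIntegralUpTo.const_mul (h : HasPVIntegralUpTo f P T v) (c : ℂ) :
    HasPVIntegralUpTo (fun τ => c * f τ) P T (c * v) := by
  rw [hasPVIntegralUpTo_iff] at h ⊢
  simpa only [integral_const_mul] using Tendsto.const_mul c h

lemma HasPVIntegralUpTo.add (hf : HasPVIntegralUpTo f P T v) (hg : HasPVIntegralUpTo g P T u)
    (hfc : ContinuousOn f (Icc (-T) T \ P)) (hgc : ContinuousOn g (Icc (-T) T \ P)) :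
    HasPVIntegralUpTo (fun τ => f τ + g τ) P T (v + u) := by
  rw [hasPVIntegralUpTo_iff] at hf hg ⊢
  refine (Tendsto.add hf hg).congr' ?_
  filter_upwards [self_mem_nhdsWithin] with ε hε
  exact (integral_add (integrableOn_excised hfc hε) (integrableOn_excised hgc hε)).symm

lemma HasPVIntegralUpTo.sum {ι : Type*} (s : Finset ι) {F : ι → ℝ → ℂ} {V : ι → ℂ}
    (hF : ∀ i ∈ s, HasPVIntegralUpTo (F i) P T (V i))
    (hc : ∀ i ∈ s, ContinuousOn (F i) (Icc (-T) T \ P)) :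
    HasPVIntegralUpTo (fun τ => ∑ i ∈ s, F i τ) P T (∑ i ∈ s, V i) := by
  rw [hasPVIntegralUpTo_iff]
  refine (tendsto_finsetSum s fun i hi => hasPVIntegralUpTo_iff.1 (hF i hi)).congr' ?_
  filter_upwards [self_mem_nhdsWithin] with ε hε
  exact (integral_finsetSum s fun i hi => integrableOn_excised (hc i hi) hε).symm

lemma exists_isolating (hP : ∀ M : ℝ, (P ∩ Icc (-M) M).Finite) (p : ℝ) :
    ∃ δ > 0, ∀ q ∈ P, q ≠ p → δ ≤ |q - p| := by
  set M := |p| + 1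
  have hcl : IsClosed ((P ∩ Icc (-M) M) \ {p}) := (hP M).sdiff.isClosed
  obtain ⟨δ, hδ, hb⟩ := Metric.isOpen_iff.1 hcl.isOpen_compl p (fun h => h.2 rfl)
  refine ⟨min δ 1, lt_min hδ one_pos, fun q hq hqp => ?_⟩
  by_contra! hlt
  have h1 : |q - p| < 1 := hlt.trans_le (min_le_right _ _)
  have h2 : |q - p| < δ := hlt.trans_le (min_le_left _ _)
  refine hb (show q ∈ Metric.ball p δ by rwa [Metric.mem_ball, Real.dist_eq]) ⟨⟨hq, ?_⟩, hqp⟩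
  have h3 : |q| ≤ M := by
    have := abs_add_le (q - p) p
    rw [sub_add_cancel] at this
    linarith
  exact abs_le.1 h3

lemma eventually_mem_excised (hP : ∀ M : ℝ, (P ∩ Icc (-M) M).Finite) {τ : ℝ}
    (hτ : τ ∈ Icc (-T) T) (hτP : τ ∉ P) : ∀ᶠ ε in 𝓝[>] (0 : ℝ), τ ∈ excised P T ε := by
  obtain ⟨δ, hδ, h⟩ := exists_isolating hP τ
  filter_upwards [Ioo_mem_nhdsGT hδ] with ε hε
  refine ⟨hτ, fun p hp => ?_⟩
  rw [abs_sub_comm]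
  exact hε.2.le.trans (h p hp fun h => hτP (h ▸ hp))

lemma ae_notMem (hP : ∀ M : ℝ, (P ∩ Icc (-M) M).Finite) : ∀ᵐ τ : ℝ, τ ∉ P := by
  have hc : P.Countable := by
    have : P = ⋃ n : ℕ, P ∩ Icc (-(n : ℝ)) n := by
      ext q
      simp only [mem_iUnion, mem_inter_iff, exists_and_left, iff_self_and]
      intro _
      obtain ⟨n, hn⟩ := exists_nat_ge |q|
      exact ⟨n, abs_le.1 hn⟩
    rw [this]
    exact countable_iUnion fun n => (hP n).countable
  exact measure_eq_zero_iff_ae_notMem.1 (hc.measure_zero _)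

/-- A continuous function is its own principal value. -/
lemma hasPVIntegralUpTo_of_continuousOn (hP : ∀ M : ℝ, (P ∩ Icc (-M) M).Finite) (hT : 0 ≤ T)
    (hf : ContinuousOn f (Icc (-T) T)) : HasPVIntegralUpTo f P T (∫ τ in (-T)..T, f τ) := by
  rw [hasPVIntegralUpTo_iff, intervalIntegral.integral_of_le (by linarith),
    ← integral_Icc_eq_integral_Ioc]
  have hi : IntegrableOn f (Icc (-T) T) := hf.integrableOn_compact isCompact_Icc
  have heq : ∀ ε, ∫ τ in excised P T ε, f τ
      = ∫ τ in Icc (-T) T, (excised P T ε).indicator f τ := fun ε => by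
    rw [setIntegral_indicator (isClosed_excised P T ε).measurableSet,
      inter_eq_right.2 (fun τ hτ => hτ.1)]
  simp_rw [heq]
  refine tendsto_integral_filter_of_dominated_convergence (fun τ => ‖f τ‖)
    (Eventually.of_forall fun ε => hi.aestronglyMeasurable.indicator
      (isClosed_excised P T ε).measurableSet)
    (Eventually.of_forall fun ε => Eventually.of_forall fun τ => norm_indicator_le_norm_self _ _)
    hi.norm ?_
  filter_upwards [ae_restrict_mem measurableSet_Icc, ae_restrict_of_ae (ae_notMem hP)] with τ h1 h2
  refine tendsto_const_nhds.congr' ?_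
  filter_upwards [eventually_mem_excised hP h1 h2] with ε hε
  rw [indicator_of_mem hε]

/-- The principal value at a single singularity does not feel the excision of other points. -/
lemma hasPVIntegralUpTo_of_singularity (hP : ∀ M : ℝ, (P ∩ Icc (-M) M).Finite) {p : ℝ}
    (hpP : p ∈ P) (hp : p ∈ Ioo (-T) T) (hf : ContinuousOn f (Icc (-T) T \ {p}))
    (hv : Tendsto (fun ε => (∫ τ in (-T)..(p - ε), f τ) + ∫ τ in (p + ε)..T, f τ)
      (𝓝[>] 0) (𝓝 v)) : HasPVIntegralUpTo f P T v := by
  rw [hasPVIntegralUpTo_iff]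
  obtain ⟨δ, hδ, hiso⟩ := exists_isolating hP p
  set K := excised {p} T (δ / 2) with hK
  have hKc : IsCompact K := isCompact_excised _ _ _
  have hKi : IntegrableOn f K :=
    (hf.mono (excised_subset (half_pos hδ))).integrableOn_compact hKc
  have hsub : ∀ ε, excised P T ε ⊆ excised {p} T ε := fun ε τ hτ =>
    ⟨hτ.1, fun q hq => by rw [hq]; exact hτ.2 p hpP⟩
  -- the part excised about the other points
  have h0 : Tendsto (fun ε => ∫ τ in K, (excised P T ε)ᶜ.indicator f τ) (𝓝[>] 0) (𝓝 0) := by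
    have : (0 : ℂ) = ∫ τ in K, (0 : ℂ) := by simp
    rw [this]
    refine tendsto_integral_filter_of_dominated_convergence (fun τ => ‖f τ‖)
      (Eventually.of_forall fun ε => hKi.aestronglyMeasurable.indicator
        (isClosed_excised P T ε).measurableSet.compl)
      (Eventually.of_forall fun ε => Eventually.of_forall fun τ => norm_indicator_le_norm_self _ _)
      hKi.norm ?_
    filter_upwards [ae_restrict_mem hKc.measurableSet, ae_restrict_of_ae (ae_notMem hP)]
      with τ h1 h2
    refine tendsto_const_nhds.congr' ?_
    filter_upwards [eventually_mem_excised hP h1.1 h2] with ε hε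
    rw [indicator_of_notMem (by simpa using hε)]
  have h1 := hv.sub h0
  rw [sub_zero] at h1
  refine h1.congr' ?_
  filter_upwards [Ioo_mem_nhdsGT (half_pos hδ),
    Ioo_mem_nhdsGT (show 0 < p - -T by linarith [hp.1]),
    Ioo_mem_nhdsGT (show 0 < T - p by linarith [hp.2])] with ε hε hε1 hε2
  have hBi : IntegrableOn f (excised {p} T ε) :=
    (hf.mono (excised_subset hε.1)).integrableOn_compact (isCompact_excised _ _ _)
  have hB : excised {p} T ε = Icc (-T) (p - ε) ∪ Icc (p + ε) T := by
    ext τ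
    simp only [excised, mem_singleton_iff, forall_eq, mem_ofPred_eq, mem_union, mem_Icc, le_abs]
    constructor
    · rintro ⟨⟨h1, h2⟩, h | h⟩
      · exact Or.inr ⟨by linarith, h2⟩
      · exact Or.inl ⟨h1, by linarith⟩
    · rintro (⟨h1, h2⟩ | ⟨h1, h2⟩)
      · exact ⟨⟨h1, by linarith [hε.1, hp.2]⟩, Or.inr (by linarith)⟩
      · exact ⟨⟨by linarith [hε.1, hp.1], h2⟩, Or.inl (by linarith)⟩
  have hBint : (∫ τ in (-T)..(p - ε), f τ) + ∫ τ in (p + ε)..T, f τ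
      = ∫ τ in excised {p} T ε, f τ := by
    rw [hB] at hBi ⊢
    rw [setIntegral_union ?_ measurableSet_Icc (hBi.mono_set subset_union_left)
      (hBi.mono_set subset_union_right),
      intervalIntegral.integral_of_le (by linarith [hε1.2]),
      intervalIntegral.integral_of_le (by linarith [hε2.2]), integral_Icc_eq_integral_Ioc,
      integral_Icc_eq_integral_Ioc]
    refine Set.disjoint_left.2 fun τ h1 h2 => ?_
    linarith [h1.2, h2.1, hε.1]
  -- For ε < δ/2, a point within ε of another element of P is at distance at least δ/2 from p, so
  -- the additional excisions all lie in K, where f is integrable.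
  have hdiff : ∫ τ in K, (excised P T ε)ᶜ.indicator f τ
      = ∫ τ in excised {p} T ε \ excised P T ε, f τ := by
    rw [setIntegral_indicator (isClosed_excised P T ε).measurableSet.compl, ← sdiff_eq]
    congr 2
    ext τ
    constructor
    · rintro ⟨h1, h2⟩
      exact ⟨⟨h1.1, fun q hq => hε.2.le.trans (h1.2 q hq)⟩, h2⟩
    · rintro ⟨h1, h2⟩
      refine ⟨⟨h1.1, fun q hq => ?_⟩, h2⟩
      rw [mem_singleton_iff.1 hq]
      have h3 : ∃ r ∈ P, |τ - r| < ε := by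
        by_contra! hcon
        exact h2 ⟨h1.1, hcon⟩
      obtain ⟨r, hr, hrτ⟩ := h3
      have hrp : r ≠ p := fun h => by
        rw [h] at hrτ
        exact absurd (h1.2 p rfl) hrτ.not_ge
      have h4 := hiso r hr hrp
      have h5 := abs_sub_le r τ p
      rw [abs_sub_comm r τ] at h5
      linarith [hε.2]
  rw [hBint, hdiff, setIntegral_sdiff (isClosed_excised P T ε).measurableSet hBi (hsub ε)]
  ring

end PV

/-! ### The closed path in the plane of `w = e^{iθ}` -/

/-- The image of the curve under `w = e^{iθ}`. -/
noncomputable def curveW (τ : ℝ) : ℂ := cexp (I * theta τ)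

/-- The image of the horizontal line through `θ(T)` under `w = e^{iθ}`. -/
noncomputable def arcW (T X : ℝ) : ℂ := cexp (I * (X + (theta T).im * I))

lemma curveW_ne_zero (τ : ℝ) : curveW τ ≠ 0 := Complex.exp_ne_zero _

lemma arcW_ne_zero (T X : ℝ) : arcW T X ≠ 0 := Complex.exp_ne_zero _

lemma hasDerivAt_curveW (τ : ℝ) :
    HasDerivAt curveW (I * curveW τ * deriv theta τ) τ :=
  ((hasDerivAt_theta τ).const_mul I).cexp.congr_deriv (by rw [curveW]; ring)

lemma hasDerivAt_arcW (T X : ℝ) : HasDerivAt (arcW T) (I * arcW T X) X :=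
  ((hasDerivAt_horizontal ((theta T).im * I) X).const_mul I).cexp.congr_deriv (by rw [arcW]; ring)

lemma continuous_curveW : Continuous curveW :=
  continuous_iff_continuousAt.2 fun τ => (hasDerivAt_curveW τ).continuousAt

lemma continuous_arcW (T : ℝ) : Continuous (arcW T) :=
  continuous_iff_continuousAt.2 fun X => (hasDerivAt_arcW T X).continuousAt

lemma arcW_theta_re (T : ℝ) : arcW T (theta T).re = curveW T := by
  rw [arcW, curveW, re_add_im]

lemma arcW_theta_neg_re (T : ℝ) : arcW T (theta (-T)).re = curveW (-T) := by
  rw [arcW, curveW, ← theta_neg_im T, re_add_im]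

/-- The vertical sides of the θ-contour collapse, so the path closes up without them. -/
lemma arcW_neg_pi (T : ℝ) : arcW T (-Real.pi) = arcW T Real.pi := by
  rw [arcW, arcW, Complex.exp_eq_exp_iff_exists_int]
  exact ⟨-1, by push_cast; ring⟩

lemma arg_exp_I_mul {θ : ℂ} (h : θ.re ∈ Ioc (-Real.pi) Real.pi) : arg (cexp (I * θ)) = θ.re := by
  have : (I * θ).im = θ.re := by simp
  rw [Complex.arg_exp, this]
  exact (toIocMod_eq_self Real.two_pi_pos).2 ⟨h.1, by linarith [h.2]⟩

lemma log_norm_exp_I_mul (θ : ℂ) : Real.log ‖cexp (I * θ)‖ = -θ.im := by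
  rw [norm_exp, Real.log_exp]
  simp

/-- Polar coordinates: arg w = Re θ and log|w| = -Im θ. Hence the graph over Re θ becomes a polar
graph. -/
lemma arg_curveW (τ : ℝ) : arg (curveW τ) = (theta τ).re :=
  arg_exp_I_mul ⟨(theta_re_mem τ).1, (theta_re_mem τ).2.le⟩

lemma log_norm_curveW (τ : ℝ) : Real.log ‖curveW τ‖ = -(theta τ).im := log_norm_exp_I_mul _

lemma arg_arcW {T X : ℝ} (h : X ∈ Ioc (-Real.pi) Real.pi) : arg (arcW T X) = X := by
  simpa [arcW] using arg_exp_I_mul (θ := X + (theta T).im * I) (by simpa using h)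

lemma log_norm_arcW (T X : ℝ) : Real.log ‖arcW T X‖ = -(theta T).im := by
  simpa [arcW] using log_norm_exp_I_mul (X + (theta T).im * I)

lemma curveW_injective : Function.Injective curveW := fun s t h => by
  apply theta_injective
  have h1 := congrArg arg h
  have h2 := congrArg (fun z => Real.log ‖z‖) h
  simp only [arg_curveW, log_norm_curveW] at h1 h2
  exact Complex.ext h1 (neg_injective h2)

/-- The parameters of the two arcs. -/
def arcParams (T : ℝ) : Set ℝ :=
  Icc (-Real.pi) (theta (-T)).re ∪ Icc (theta T).re Real.pi

/-- The closed path: the curve for `|τ| ≤ T`, closed by arcs of the circle through `w(±T)`. -/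
def closedPath (T : ℝ) : Set ℂ := curveW '' Icc (-T) T ∪ arcW T '' arcParams T

/-! ### Integrals along the closed path by primitives -/

lemma integral_curveW {L L' : ℂ → ℂ} {s t : ℝ} (hst : s ≤ t)
    (hL : ∀ τ ∈ Icc s t, HasDerivAt L (L' (curveW τ)) (curveW τ))
    (hc : ∀ τ ∈ Icc s t, ContinuousAt L' (curveW τ)) :
    ∫ τ in s..t, L' (curveW τ) * (I * curveW τ * deriv theta τ)
      = L (curveW t) - L (curveW s) := by
  refine intervalIntegral.integral_eq_sub_of_hasDerivAt (f := fun τ => L (curveW τ))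
    (fun τ hτ => ?_) (ContinuousOn.intervalIntegrable fun τ hτ => ?_) <;>
  rw [uIcc_of_le hst] at hτ
  · exact (hL τ hτ).comp τ (hasDerivAt_curveW τ)
  · exact (((hc τ hτ).comp continuous_curveW.continuousAt).mul
      ((continuous_const.mul continuous_curveW).mul
        continuous_deriv_theta).continuousAt).continuousWithinAt

lemma integral_arcW {L L' : ℂ → ℂ} {T s t : ℝ} (hst : s ≤ t)
    (hL : ∀ X ∈ Icc s t, HasDerivAt L (L' (arcW T X)) (arcW T X))
    (hc : ∀ X ∈ Icc s t, ContinuousAt L' (arcW T X)) :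
    ∫ X in s..t, L' (arcW T X) * (I * arcW T X) = L (arcW T t) - L (arcW T s) := by
  refine intervalIntegral.integral_eq_sub_of_hasDerivAt (f := fun X => L (arcW T X))
    (fun X hX => ?_) (ContinuousOn.intervalIntegrable fun X hX => ?_) <;>
  rw [uIcc_of_le hst] at hX
  · exact (hL X hX).comp X (hasDerivAt_arcW T X)
  · exact (((hc X hX).comp (continuous_arcW T).continuousAt).mul
      (continuous_const.mul (continuous_arcW T)).continuousAt).continuousWithinAt

/-- The integral of `φ(w) dw` along the curve for `|τ| ≤ T`. -/
noncomputable def curveInt (φ : ℂ → ℂ) (T : ℝ) : ℂ :=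
  ∫ τ in (-T)..T, φ (curveW τ) * (I * curveW τ * deriv theta τ)

/-- The integral of `φ(w) dw` along the two arcs. -/
noncomputable def arcInt (φ : ℂ → ℂ) (T : ℝ) : ℂ :=
  (∫ X in (-Real.pi)..(theta (-T)).re, φ (arcW T X) * (I * arcW T X))
    + ∫ X in (theta T).re..Real.pi, φ (arcW T X) * (I * arcW T X)

lemma arcInt_of_primitive {L L' : ℂ → ℂ} {T : ℝ}
    (hL : ∀ X ∈ arcParams T, HasDerivAt L (L' (arcW T X)) (arcW T X))
    (hc : ∀ X ∈ arcParams T, ContinuousAt L' (arcW T X)) :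
    arcInt L' T = L (curveW (-T)) - L (curveW T) := by
  rw [arcInt, integral_arcW (theta_re_mem (-T)).1.le (fun X hX => hL X (Or.inl hX))
    (fun X hX => hc X (Or.inl hX)), integral_arcW (theta_re_mem T).2.le
    (fun X hX => hL X (Or.inr hX)) (fun X hX => hc X (Or.inr hX)), arcW_theta_re,
    arcW_theta_neg_re, arcW_neg_pi]
  ring

lemma closed_integral_of_primitive {L L' : ℂ → ℂ} {T : ℝ} (hT : 0 < T)
    (hL : ∀ w ∈ closedPath T, HasDerivAt L (L' w) w)
    (hc : ∀ w ∈ closedPath T, ContinuousAt L' w) : curveInt L' T + arcInt L' T = 0 := by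
  rw [curveInt, integral_curveW (by linarith : -T ≤ T) (fun τ hτ => hL _ (Or.inl ⟨τ, hτ, rfl⟩))
    (fun τ hτ => hc _ (Or.inl ⟨τ, hτ, rfl⟩)), arcInt_of_primitive
    (fun X hX => hL _ (Or.inr ⟨X, hX, rfl⟩)) (fun X hX => hc _ (Or.inr ⟨X, hX, rfl⟩))]
  ring

/-- Since dw/w = i dθ, the integral is i times the total change of θ, in which Re θ runs from -π to
π and the heights cancel. -/
lemma closed_integral_inv (T : ℝ) :
    curveInt (fun w => w⁻¹) T + arcInt (fun w => w⁻¹) T = 2 * Real.pi * I := by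
  have h1 : curveInt (fun w => w⁻¹) T = I * (theta T - theta (-T)) := by
    have h2 : curveInt (fun w => w⁻¹) T = ∫ τ in (-T)..T, I * deriv theta τ := by
      refine intervalIntegral.integral_congr fun τ _ => ?_
      have := curveW_ne_zero τ
      simp only []
      field_simp
    rw [h2, intervalIntegral.integral_const_mul, intervalIntegral.integral_deriv_eq_sub
      (fun τ _ => (hasDerivAt_theta τ).differentiableAt)
      (continuous_deriv_theta.intervalIntegrable _ _)]
  have h3 : ∀ s t : ℝ, ∫ X in s..t, (fun w : ℂ => w⁻¹) (arcW T X) * (I * arcW T X)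
      = I * (t - s) := fun s t => by
    have : ∀ X, (fun w : ℂ => w⁻¹) (arcW T X) * (I * arcW T X) = I := fun X => by
      have := arcW_ne_zero T X
      simp only []
      field_simp
    simp_rw [this]
    simp [mul_comm]
  rw [h1, arcInt, h3, h3]
  have h4 : theta T - theta (-T) = 2 * (theta T).re := by
    apply Complex.ext <;> simp
    ring
  rw [h4, theta_neg_re]
  push_cast
  ring

/-! ### The position of a point relative to the path -/

/-- The logarithm of the radius of the path in the direction `β`. -/
noncomputable def pathLogRadius (T β : ℝ) : ℝ :=
  if |β| < (theta T).re then -Real.log (Real.sinc β) else -(theta T).im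

/-- Only X = -π lies outside the range of `arg`; it is replaced by π, which gives the same point. -/
lemma exists_param_pos {T X : ℝ} (hT : 0 < T) (hX : X ∈ arcParams T) :
    ∃ X' ∈ Ioc (-Real.pi) Real.pi, arcW T X' = arcW T X ∧ (theta T).re ≤ |X'| := by
  have hpi := Real.pi_pos
  have h1 := theta_re_pos hT
  rcases eq_or_ne X (-Real.pi) with h | h
  · refine ⟨Real.pi, ⟨by linarith, le_rfl⟩, by rw [h, arcW_neg_pi], ?_⟩
    rw [abs_of_pos hpi]
    exact (theta_re_mem T).2.le
  · refine ⟨X, ?_, rfl, ?_⟩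
    · rcases hX with hX | hX
      · exact ⟨lt_of_le_of_ne hX.1 h.symm, hX.2.trans (theta_re_mem _).2.le⟩
      · exact ⟨(theta_re_mem T).1.trans_le hX.1, hX.2⟩
    · rcases hX with hX | hX
      · rw [theta_neg_re] at hX
        exact le_abs.2 (Or.inr (by linarith [hX.2]))
      · exact le_abs.2 (Or.inl hX.1)

lemma log_norm_eq_of_mem_closedPath {T : ℝ} (hT : 0 < T) {w : ℂ} (hw : w ∈ closedPath T) :
    w ≠ 0 ∧ Real.log ‖w‖ = pathLogRadius T (arg w) := by
  rcases hw with ⟨τ, hτ, rfl⟩ | ⟨X, hX, rfl⟩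
  · refine ⟨curveW_ne_zero τ, ?_⟩
    rw [arg_curveW, log_norm_curveW, pathLogRadius]
    split_ifs with h
    · rw [theta_im]
    · rcases eq_or_lt_of_le (abs_le.2 hτ) with h1 | h1
      · rcases abs_choice τ with h2 | h2
        · rw [← h1, h2]
        · rw [← h1, h2, theta_neg_im]
      · exact absurd (theta_re_lt_theta_re h1) h
  · refine ⟨arcW_ne_zero T X, ?_⟩
    obtain ⟨X', h1, h2, h3⟩ := exists_param_pos hT hX
    rw [← h2, arg_arcW h1, log_norm_arcW, pathLogRadius, if_neg h3.not_gt]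

lemma pathLogRadius_le {T : ℝ} (hT : 0 < T) (β : ℝ) : pathLogRadius T β ≤ -(theta T).im := by
  rw [pathLogRadius]
  split_ifs with h
  · rw [theta_im, neg_le_neg_iff]
    refine (log_sinc_lt_log_sinc (theta_re_mem T) ?_).le
    rwa [abs_of_pos (theta_re_pos hT)]
  · exact le_rfl

/-- The number 1 - w/a meets the cut only if w = ra with r ≥ 1, that is, on the same ray and at
least as far out. This reduces the winding numbers to comparing radii. -/
lemma one_sub_div_mem_slitPlane {w a : ℂ} (hw : w ≠ 0) (ha : a ≠ 0)
    (h : arg w = arg a → Real.log ‖w‖ < Real.log ‖a‖) : 1 - w / a ∈ slitPlane := by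
  rw [mem_slitPlane_iff]
  by_contra! hcon
  obtain ⟨h1, h2⟩ := hcon
  set r := (w / a).re with hr
  have h3 : 1 ≤ r := by simpa using h1
  have h4 : w / a = r := by
    apply Complex.ext
    · simp [hr]
    · simpa using h2
  have h5 : w = r * a := by rw [← h4]; field_simp
  have h6 : arg w = arg a := by rw [h5, arg_real_mul _ (by linarith)]
  have h7 := h h6
  rw [Real.log_lt_log_iff (norm_pos_iff.2 hw) (norm_pos_iff.2 ha), h5, norm_mul, norm_real,
    Real.norm_of_nonneg (by linarith)] at h7
  nlinarith [norm_pos_iff.2 ha]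

lemma hasDerivAt_log_one_sub_div {w a : ℂ} (ha : a ≠ 0) (h : 1 - w / a ∈ slitPlane) :
    HasDerivAt (fun w => log (1 - w / a)) ((w - a)⁻¹) w := by
  have h1 : HasDerivAt (fun w => 1 - w / a) (-(1 / a)) w :=
    ((hasDerivAt_id w).div_const a).const_sub 1
  refine (h1.clog h).congr_deriv ?_
  have h2 := slitPlane_ne_zero h
  have h3 : w - a ≠ 0 := fun h0 => h2 (by rw [sub_eq_zero.1 h0, div_self ha, sub_self])
  have h4 : 1 - w / a = -(w - a) / a := by field_simp; ring
  rw [h4]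
  field_simp

lemma hasDerivAt_log_one_sub_div' {w a : ℂ} (hw : w ≠ 0) (h : 1 - a / w ∈ slitPlane) :
    HasDerivAt (fun w => log (1 - a / w)) ((w - a)⁻¹ - w⁻¹) w := by
  have h1 : HasDerivAt (fun w => 1 - a / w) (a / w ^ 2) w := by
    have := ((hasDerivAt_inv hw).const_mul a).const_sub 1
    refine (this.congr_deriv (by ring))
  refine (h1.clog h).congr_deriv ?_
  have h2 := slitPlane_ne_zero h
  have h3 : w - a ≠ 0 := fun h0 => h2 (by rw [← sub_eq_zero.1 h0, div_self hw, sub_self])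
  have h4 : 1 - a / w = (w - a) / w := by field_simp
  rw [h4]
  field_simp
  ring

lemma curveInt_sub {φ ψ : ℂ → ℂ} {T : ℝ} (hT : 0 < T) (hφ : ContinuousOn φ (closedPath T))
    (hψ : ContinuousOn ψ (closedPath T)) :
    curveInt (fun w => φ w - ψ w) T = curveInt φ T - curveInt ψ T := by
  have key : ∀ χ : ℂ → ℂ, ContinuousOn χ (closedPath T) → IntervalIntegrable
      (fun τ => χ (curveW τ) * (I * curveW τ * deriv theta τ)) volume (-T) T := fun χ hχ => by
    refine ContinuousOn.intervalIntegrable ?_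
    rw [uIcc_of_le (by linarith)]
    exact (hχ.comp continuous_curveW.continuousOn fun τ hτ => Or.inl ⟨τ, hτ, rfl⟩).mul
      ((continuous_const.mul continuous_curveW).mul continuous_deriv_theta).continuousOn
  rw [curveInt, curveInt, curveInt, ← intervalIntegral.integral_sub (key φ hφ) (key ψ hψ)]
  simp only [sub_mul]

lemma intervalIntegrable_arc {χ : ℂ → ℂ} {T s t : ℝ} (hst : s ≤ t)
    (hχ : ContinuousOn χ (arcW T '' arcParams T)) (h : Icc s t ⊆ arcParams T) :
    IntervalIntegrable (fun X => χ (arcW T X) * (I * arcW T X)) volume s t := by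
  refine ContinuousOn.intervalIntegrable ?_
  rw [uIcc_of_le hst]
  exact (hχ.comp (continuous_arcW T).continuousOn fun X hX => ⟨X, h hX, rfl⟩).mul
    (continuous_const.mul (continuous_arcW T)).continuousOn

lemma arcInt_add {φ ψ : ℂ → ℂ} {T : ℝ} (hφ : ContinuousOn φ (arcW T '' arcParams T))
    (hψ : ContinuousOn ψ (arcW T '' arcParams T)) :
    arcInt (fun w => φ w + ψ w) T = arcInt φ T + arcInt ψ T := by
  have h1 := (theta_re_mem (-T)).1.le
  have h2 := (theta_re_mem T).2.le
  simp only [arcInt, add_mul]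
  rw [intervalIntegral.integral_add (intervalIntegrable_arc h1 hφ subset_union_left)
    (intervalIntegrable_arc h1 hψ subset_union_left),
    intervalIntegral.integral_add (intervalIntegrable_arc h2 hφ subset_union_right)
    (intervalIntegrable_arc h2 hψ subset_union_right)]
  ring

lemma arcInt_const_mul (φ : ℂ → ℂ) (T : ℝ) (c : ℂ) :
    arcInt (fun w => c * φ w) T = c * arcInt φ T := by
  simp only [arcInt, mul_assoc, intervalIntegral.integral_const_mul]
  ring

lemma arcInt_congr {φ ψ : ℂ → ℂ} {T : ℝ} (h : EqOn φ ψ (arcW T '' arcParams T)) :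
    arcInt φ T = arcInt ψ T := by
  have h1 := (theta_re_mem (-T)).1.le
  have h2 := (theta_re_mem T).2.le
  rw [arcInt, arcInt]
  congr 1 <;> refine intervalIntegral.integral_congr fun X hX => ?_
  · rw [uIcc_of_le h1] at hX
    exact congrArg (· * (I * arcW T X)) (h ⟨X, Or.inl hX, rfl⟩)
  · rw [uIcc_of_le h2] at hX
    exact congrArg (· * (I * arcW T X)) (h ⟨X, Or.inr hX, rfl⟩)

lemma arcInt_sum {ι : Type*} (s : Finset ι) {φ : ι → ℂ → ℂ} {T : ℝ}
    (hφ : ∀ i ∈ s, ContinuousOn (φ i) (arcW T '' arcParams T)) :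
    arcInt (fun w => ∑ i ∈ s, φ i w) T = ∑ i ∈ s, arcInt (φ i) T := by
  classical
  induction s using Finset.induction_on with
  | empty => simp [arcInt]
  | insert i s hi ih =>
    simp only [Finset.sum_insert hi]
    rw [arcInt_add (hφ i (Finset.mem_insert_self _ _)) (continuousOn_finsetSum _ fun j hj =>
      hφ j (Finset.mem_insert_of_mem hj)), ih fun j hj => hφ j (Finset.mem_insert_of_mem hj)]

/-- The winding number about a point outside the path is `0`. -/
lemma closed_integral_outside {T : ℝ} (hT : 0 < T) {a : ℂ} (ha : a ≠ 0)
    (h : pathLogRadius T (arg a) < Real.log ‖a‖) :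
    a ∉ closedPath T ∧
    curveInt (fun w => (w - a)⁻¹) T + arcInt (fun w => (w - a)⁻¹) T = 0 := by
  -- From outside, log(1 - w/a) is a single-valued primitive of 1/(w - a) along the whole path.
  have hs : ∀ w ∈ closedPath T, 1 - w / a ∈ slitPlane := fun w hw => by
    obtain ⟨h1, h2⟩ := log_norm_eq_of_mem_closedPath hT hw
    exact one_sub_div_mem_slitPlane h1 ha fun h3 => by rwa [h2, h3]
  have hmem : a ∉ closedPath T := fun hw => by
    have := (log_norm_eq_of_mem_closedPath hT hw).2
    linarith
  refine ⟨hmem, closed_integral_of_primitive hT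
    (fun w hw => hasDerivAt_log_one_sub_div ha (hs w hw)) fun w hw => ?_⟩
  exact ContinuousAt.inv₀ (by fun_prop) (sub_ne_zero.2 fun h => hmem (h ▸ hw))

/-- The winding number about a point inside the path is `1`. -/
lemma closed_integral_inside {T : ℝ} (hT : 0 < T) {a : ℂ}
    (h : a = 0 ∨ Real.log ‖a‖ < pathLogRadius T (arg a)) :
    a ∉ closedPath T ∧
    curveInt (fun w => (w - a)⁻¹) T + arcInt (fun w => (w - a)⁻¹) T = 2 * Real.pi * I := by
  -- From inside, log(1 - a/w) is a primitive of 1/(w - a) - 1/w, so the winding number is that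
  -- about 0.
  have hs : ∀ w ∈ closedPath T, w ≠ 0 ∧ 1 - a / w ∈ slitPlane := fun w hw => by
    obtain ⟨h1, h2⟩ := log_norm_eq_of_mem_closedPath hT hw
    refine ⟨h1, ?_⟩
    rcases eq_or_ne a 0 with h0 | h0
    · simp [h0]
    · exact one_sub_div_mem_slitPlane h0 h1 fun h3 => by
        rw [h2, ← h3]
        exact h.resolve_left h0
  have hmem : a ∉ closedPath T := fun hw => by
    have := log_norm_eq_of_mem_closedPath hT hw
    linarith [h.resolve_left this.1, this.2]
  have c1 : ∀ w ∈ closedPath T, ContinuousAt (fun w => (w - a)⁻¹) w := fun w hw =>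
    ContinuousAt.inv₀ (by fun_prop) (sub_ne_zero.2 fun h => hmem (h ▸ hw))
  have c2 : ∀ w ∈ closedPath T, ContinuousAt (fun w : ℂ => w⁻¹) w := fun w hw =>
    continuousAt_inv₀ (hs w hw).1
  refine ⟨hmem, ?_⟩
  have h1 := closed_integral_of_primitive hT
    (fun w hw => hasDerivAt_log_one_sub_div' (hs w hw).1 (hs w hw).2)
    fun w hw => (c1 w hw).sub (c2 w hw)
  have k1 : ContinuousOn (fun w => (w - a)⁻¹) (closedPath T) := fun w hw =>
    (c1 w hw).continuousWithinAt
  have k2 : ContinuousOn (fun w : ℂ => w⁻¹) (closedPath T) := fun w hw =>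
    (c2 w hw).continuousWithinAt
  have h2 := arcInt_add (T := T) (φ := fun w => (w - a)⁻¹) (ψ := fun w : ℂ => -1 * w⁻¹)
    (k1.mono subset_union_right) ((continuousOn_const.mul k2).mono subset_union_right)
  rw [arcInt_const_mul (fun w : ℂ => w⁻¹)] at h2
  have h3 : (fun w : ℂ => (w - a)⁻¹ + -1 * w⁻¹) = fun w => (w - a)⁻¹ - w⁻¹ := by
    ext w; ring
  rw [h3] at h2
  rw [curveInt_sub hT k1 k2, h2] at h1
  have h4 := closed_integral_inv T
  linear_combination h1 + h4

/-- The principal value of the winding number about a point of the curve is `1/2`. -/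
lemma tendsto_closed_integral_on {T p : ℝ} (hp : p ∈ Ioo (-T) T)
    (hT : 0 < T) :
    Tendsto (fun ε => (∫ τ in (-T)..(p - ε),
        (curveW τ - curveW p)⁻¹ * (I * curveW τ * deriv theta τ))
        + ∫ τ in (p + ε)..T, (curveW τ - curveW p)⁻¹ * (I * curveW τ * deriv theta τ))
      (𝓝[>] 0) (𝓝 (Real.pi * I - arcInt (fun w => (w - curveW p)⁻¹) T)) := by
  set a := curveW p with ha
  have ha0 : a ≠ 0 := curveW_ne_zero p
  have hpT : |p| < T := abs_lt.2 hp
  have harg : |arg a| < (theta T).re := by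
    rw [ha, arg_curveW]; exact theta_re_lt_theta_re hpT
  set L : ℂ → ℂ := fun w => log (1 - w / a) with hL
  -- Different points of the curve have different arguments, so the comparison of radii is never
  -- required; the same holds for the arcs.
  have hcurve : ∀ τ, τ ≠ p → 1 - curveW τ / a ∈ slitPlane := fun τ hτ =>
    one_sub_div_mem_slitPlane (curveW_ne_zero τ) ha0 fun h => by
      exfalso
      rw [ha, arg_curveW, arg_curveW] at h
      apply hτ
      apply theta_injective
      rw [theta_eq_graphPt τ, h, ← theta_eq_graphPt p]
  have harc : ∀ X ∈ arcParams T, 1 - arcW T X / a ∈ slitPlane := fun X hX =>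
    one_sub_div_mem_slitPlane (arcW_ne_zero T X) ha0 fun h => by
      exfalso
      obtain ⟨X', h1, h2, h3⟩ := exists_param_pos hT hX
      rw [← h2, arg_arcW h1] at h
      rw [h] at h3
      linarith
  have hcont : ∀ w, 1 - w / a ∈ slitPlane → ContinuousAt (fun w => (w - a)⁻¹) w := fun w hw =>
    ContinuousAt.inv₀ (by fun_prop) (sub_ne_zero.2 fun h => slitPlane_ne_zero hw (by
      rw [h, div_self ha0, sub_self]))
  have hA := arcInt_of_primitive (T := T) (L := L) (L' := fun w => (w - a)⁻¹)
    (fun X hX => hasDerivAt_log_one_sub_div ha0 (harc X hX)) (fun X hX => hcont _ (harc X hX))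
  -- the contribution of the excised neighbourhood
  set d : ℂ := I * deriv theta p with hd
  have hdim : 0 < d.im := by rw [hd]; simpa using deriv_theta_re_pos p
  set u : ℝ → ℂ := fun τ => 1 - curveW τ / a with hu
  have hu0 : u p = 0 := by simp only [hu]; rw [← ha, div_self ha0, sub_self]
  have hud : HasDerivAt u (-d) p := by
    refine (((hasDerivAt_curveW p).div_const a).const_sub 1).congr_deriv ?_
    rw [← ha, hd]
    field_simp
  have hright : Tendsto (fun ε : ℝ => ((ε⁻¹ : ℝ) : ℂ) * u (p + ε)) (𝓝[>] 0) (𝓝 (-d)) := by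
    have := hud.tendsto_slope_zero_right
    simpa [hu0] using this
  have hleft : Tendsto (fun ε : ℝ => ((ε⁻¹ : ℝ) : ℂ) * u (p - ε)) (𝓝[>] 0) (𝓝 d) := by
    have h1 := hud.tendsto_slope_zero_left
    have h2 : Tendsto (fun ε : ℝ => -ε) (𝓝[>] 0) (𝓝[<] 0) := by
      simpa using tendsto_neg_nhdsGT (a := (0 : ℝ))
    have h3 := (h1.comp h2).neg
    simpa [hu0, Function.comp_def, ← sub_eq_add_neg, inv_neg] using h3
  -- Multiplying both arguments by 1/ε does not change the difference of the logarithms, and the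
  -- rescaled arguments tend to d and -d. As Im d = Re θ'(p) > 0, the limit is πi, half of the full
  -- turn.
  have hlog : Tendsto (fun ε : ℝ => log (u (p - ε)) - log (u (p + ε))) (𝓝[>] 0)
      (𝓝 (Real.pi * I)) := by
    have hd0 : d ≠ 0 := fun h => by simp [h] at hdim
    have h1 : d ∈ slitPlane := mem_slitPlane_iff.2 (Or.inr hdim.ne')
    have h2 : -d ∈ slitPlane := mem_slitPlane_iff.2 (Or.inr (by simpa using hdim.ne'))
    have h3 := (hleft.clog h1).sub (hright.clog h2)
    rw [log_sub_log_neg hdim] at h3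
    refine h3.congr' ?_
    filter_upwards [self_mem_nhdsWithin] with ε hε
    have hε0 : (0 : ℝ) < ε := hε
    have hε' : 0 < ε⁻¹ := inv_pos.2 hε
    rw [log_ofReal_mul hε' (slitPlane_ne_zero (hcurve _ (by linarith))),
      log_ofReal_mul hε' (slitPlane_ne_zero (hcurve _ (by linarith)))]
    ring
  refine (hlog.sub_const (arcInt (fun w => (w - a)⁻¹) T)).congr' ?_
  filter_upwards [Ioo_mem_nhdsGT (show 0 < p - -T by linarith [hp.1]),
    Ioo_mem_nhdsGT (show 0 < T - p by linarith [hp.2])] with ε hε1 hε2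
  have hε := hε1.1
  rw [hA, integral_curveW (L := L) (L' := fun w => (w - a)⁻¹) (by linarith [hε1.2])
      (fun τ hτ => hasDerivAt_log_one_sub_div ha0 (hcurve τ (by linarith [hτ.2])))
      (fun τ hτ => hcont _ (hcurve τ (by linarith [hτ.2]))),
    integral_curveW (L := L) (L' := fun w => (w - a)⁻¹) (by linarith [hε2.2])
      (fun τ hτ => hasDerivAt_log_one_sub_div ha0 (hcurve τ (by linarith [hτ.1])))
      (fun τ hτ => hcont _ (hcurve τ (by linarith [hτ.1])))]
  simp only [hL, hu]
  ring

/-! ### Weights and winding numbers -/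

lemma thetaZero_re (x ζ : ℂ) : (thetaZero x ζ).re = arg (x * ζ) := by
  simp [thetaZero]

lemma thetaZero_im (x ζ : ℂ) : (thetaZero x ζ).im = -Real.log ‖x * ζ‖ := by
  simp [thetaZero]

lemma thetaZero_eq_one_mul (x ζ : ℂ) : thetaZero x ζ = thetaZero 1 (x * ζ) := by
  rw [thetaZero, thetaZero, one_mul]

lemma exp_thetaZero {a : ℂ} (ha : a ≠ 0) : cexp (I * thetaZero 1 a) = a := by
  have h : I * thetaZero 1 a = Real.log ‖a‖ + arg a * I := by
    rw [thetaZero, one_mul]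
    linear_combination (-(Real.log ‖a‖ : ℂ)) * I_mul_I
  rw [h, Complex.exp_add, ← ofReal_exp, Real.exp_log (norm_pos_iff.2 ha), norm_mul_exp_arg_mul_I]

lemma thetaZero_curveW (p : ℝ) : thetaZero 1 (curveW p) = theta p := by
  apply Complex.ext
  · rw [thetaZero_re, one_mul, arg_curveW]
  · rw [thetaZero_im, one_mul, log_norm_curveW, neg_neg]

lemma psi_eq (θ : ℂ) : psi θ = θ.im - Real.log (Real.sinc θ.re) := by
  rw [psi]
  split_ifs with h
  · simp [h]
  · rw [Real.sinc_of_ne_zero h]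

/-- The weight with which a point `a` of the `w`-plane contributes at level `T`. -/
noncomputable def levelWeight (T : ℝ) (a : ℂ) : ℝ :=
  if (theta T).im < (thetaZero 1 a).im then weight (thetaZero 1 a) else 0

/-- With the next two lemmas: the truncated weight Θ(ψ) equals the winding number of the closed path
at nonzero points off the arcs, counted 1/2 on the curve. -/
lemma levelWeight_of_inside {T : ℝ} (hT : 0 < T) {a : ℂ}
    (h : Real.log ‖a‖ < pathLogRadius T (arg a)) : levelWeight T a = 1 := by
  have h1 := h.trans_le (pathLogRadius_le hT _)
  rw [levelWeight, if_pos (by rw [thetaZero_im, one_mul]; linarith), weight]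
  split_ifs with h2
  · rfl
  rw [thetaZero_re, one_mul] at h2
  have harg : arg a ∈ Ioo (-Real.pi) Real.pi :=
    ⟨neg_pi_lt_arg a, lt_of_le_of_ne (arg_le_pi a) h2⟩
  rw [stepTheta, if_pos]
  rw [psi_eq, thetaZero_re, thetaZero_im, one_mul]
  rw [pathLogRadius] at h
  split_ifs at h with h3
  · linarith
  -- In the directions of the arcs the curve runs at or below the height Im θ(T), so a point above
  -- that height is also above the curve.
  · rw [theta_im] at h
    rcases eq_or_lt_of_le (not_lt.1 h3) with h4 | h4
    · rw [h4, log_sinc_abs] at h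
      linarith
    · have := log_sinc_lt_log_sinc (a := (theta T).re) harg
        (by rwa [abs_of_pos (theta_re_pos hT)])
      linarith

lemma levelWeight_of_outside {T : ℝ} {a : ℂ}
    (h : pathLogRadius T (arg a) < Real.log ‖a‖) : levelWeight T a = 0 := by
  rw [levelWeight]
  split_ifs with h1
  · rw [thetaZero_im, one_mul] at h1
    rw [pathLogRadius] at h
    split_ifs at h with h2
    · have h3 : arg a ≠ Real.pi := fun h4 => by
        rw [h4, abs_of_pos Real.pi_pos] at h2
        linarith [(theta_re_mem T).2]
      have h4 : psi (thetaZero 1 a) < 0 := by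
        rw [psi_eq, thetaZero_re, thetaZero_im, one_mul]
        linarith
      rw [weight, if_neg (by rwa [thetaZero_re, one_mul]), stepTheta, if_neg h4.not_gt,
        if_neg h4.ne]
    · linarith
  · rfl

lemma levelWeight_curveW {T p : ℝ} (h : |p| < T) : levelWeight T (curveW p) = 1 / 2 := by
  have hT : 0 < T := (abs_nonneg p).trans_lt h
  have h1 : (theta T).im < (theta p).im := by
    rw [theta_im, theta_im]
    refine log_sinc_lt_log_sinc (theta_re_mem T) ?_
    rw [abs_of_pos (theta_re_pos hT)]
    exact theta_re_lt_theta_re h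
  have h2 : psi (theta p) = 0 := by rw [psi_eq, theta_im, sub_self]
  rw [levelWeight, thetaZero_curveW, if_pos h1, weight, if_neg (theta_re_mem p).2.ne, stepTheta, h2]
  simp

/-- A point on the path but not on the arcs is an inner point of the curve. -/
lemma exists_curveW_eq {T : ℝ} (hT : 0 < T) {a : ℂ} (ha : a ≠ 0)
    (harc : a ∉ arcW T '' arcParams T) (h : Real.log ‖a‖ = pathLogRadius T (arg a)) :
    ∃ p ∈ Ioo (-T) T, curveW p = a := by
  rw [pathLogRadius] at h
  split_ifs at h with h1
  · have hb : arg a ∈ Ioo (-Real.pi) Real.pi := abs_lt.1 (h1.trans (theta_re_mem T).2)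
    obtain ⟨p, hp⟩ := exists_theta_eq hb
    have hpT : |p| < T := abs_lt_of_theta_re hT (by rwa [hp, graphPt_re])
    refine ⟨p, abs_lt.1 hpT, ?_⟩
    have : theta p = thetaZero 1 a := by
      rw [hp]
      apply Complex.ext
      · rw [graphPt_re, thetaZero_re, one_mul]
      · rw [graphPt_im, thetaZero_im, one_mul, h, neg_neg]
    rw [curveW, this, exp_thetaZero ha]
  · exfalso
    apply harc
    refine ⟨arg a, ?_, ?_⟩
    · rcases le_abs.1 (not_lt.1 h1) with h2 | h2
      · exact Or.inr ⟨h2, arg_le_pi a⟩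
      · refine Or.inl ⟨(neg_pi_lt_arg a).le, ?_⟩
        rw [theta_neg_re]
        linarith
    · have : (arg a : ℂ) + (theta T).im * I = thetaZero 1 a := by
        apply Complex.ext
        · rw [thetaZero_re, one_mul]; simp
        · rw [thetaZero_im, one_mul, h]; simp
      rw [arcW, this, exp_thetaZero ha]

lemma continuousOn_simpleFraction {P : Set ℝ} {T : ℝ} {a : ℂ} (hon : ∀ p, curveW p = a → p ∈ P) :
    ContinuousOn (fun τ => (curveW τ - a)⁻¹ * (I * curveW τ * deriv theta τ)) (Icc (-T) T \ P) :=
  ((continuous_curveW.sub continuous_const).continuousOn.inv₀ fun τ hτ h =>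
    hτ.2 (hon τ (sub_eq_zero.1 h))).mul
    ((continuous_const.mul continuous_curveW).mul continuous_deriv_theta).continuousOn

/-- The principal value of `dw / (w - a)` along the closed path. -/
lemma hasPV_simpleFraction {P : Set ℝ} (hP : ∀ M : ℝ, (P ∩ Icc (-M) M).Finite) {T : ℝ}
    (hT : 0 < T) {a : ℂ} (harc : a ∉ arcW T '' arcParams T) (hon : ∀ p, curveW p = a → p ∈ P) :
    HasPVIntegralUpTo (fun τ => (curveW τ - a)⁻¹ * (I * curveW τ * deriv theta τ)) P T
      (2 * Real.pi * I * (if a = 0 then 1 else levelWeight T a : ℝ)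
        - arcInt (fun w => (w - a)⁻¹) T) := by
  have regular : a ∉ closedPath T → HasPVIntegralUpTo
      (fun τ => (curveW τ - a)⁻¹ * (I * curveW τ * deriv theta τ)) P T
      (curveInt (fun w => (w - a)⁻¹) T) := fun h => by
    refine hasPVIntegralUpTo_of_continuousOn hP hT.le ?_
    refine ((continuous_curveW.sub continuous_const).continuousOn.inv₀ fun τ hτ h0 =>
      h (Or.inl ⟨τ, hτ, sub_eq_zero.1 h0⟩)).mul
      ((continuous_const.mul continuous_curveW).mul continuous_deriv_theta).continuousOn
  have inside : (a = 0 ∨ Real.log ‖a‖ < pathLogRadius T (arg a)) → HasPVIntegralUpTo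
      (fun τ => (curveW τ - a)⁻¹ * (I * curveW τ * deriv theta τ)) P T
      (2 * Real.pi * I * (1 : ℝ) - arcInt (fun w => (w - a)⁻¹) T) := fun h => by
    obtain ⟨h1, h2⟩ := closed_integral_inside hT h
    convert regular h1 using 1
    rw [ofReal_one]
    linear_combination -h2
  split_ifs with ha
  · exact inside (Or.inl ha)
  rcases lt_trichotomy (Real.log ‖a‖) (pathLogRadius T (arg a)) with h | h | h
  · rw [levelWeight_of_inside hT h]
    exact inside (Or.inr h)
  · obtain ⟨p, hp, rfl⟩ := exists_curveW_eq hT ha harc h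
    rw [levelWeight_curveW (abs_lt.2 hp)]
    refine hasPVIntegralUpTo_of_singularity hP (hon p rfl) hp
      (continuousOn_simpleFraction fun q hq => curveW_injective hq) ?_
    convert tendsto_closed_integral_on hp hT using 2
    push_cast
    ring
  · rw [levelWeight_of_outside h]
    obtain ⟨h1, h2⟩ := closed_integral_outside hT ha h
    convert regular h1 using 1
    rw [ofReal_zero]
    linear_combination -h2

/-! ### The integrand in the `w`-plane -/

/-- The function `e^{nw} / (w^{n+1} g(w/x))`. -/
noncomputable def planeIntegrand (g : ℂ → ℂ) (x : ℂ) (n : ℕ) (w : ℂ) : ℂ :=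
  cexp (n * w) / g (w / x) / w ^ (n + 1)

section

variable {g : ℂ → ℂ} {x : ℂ} {n : ℕ}

/-- Here e^{-inθ} = w^{-n}; one factor w is split off to match dw = i w dθ, whence the exponent n +
1. -/
lemma integrand_eq (g : ℂ → ℂ) (x : ℂ) (n : ℕ) :
    integrand g x n = fun θ => cexp (I * θ) * planeIntegrand g x n (cexp (I * θ)) := by
  ext θ
  have h := Complex.exp_ne_zero (I * θ)
  rw [integrand, planeIntegrand, mul_sub, Complex.exp_sub, Complex.exp_nat_mul (I * θ)]
  field_simp
  ring

lemma finite_zeros (hg : Differentiable ℂ g) (hg0 : g 0 ≠ 0) (r : ℝ) :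
    (Metric.closedBall (0 : ℂ) r ∩ {z | g z = 0}).Finite := by
  by_contra hinf
  obtain ⟨z, -, hz⟩ := Set.Infinite.exists_accPt_of_subset_isCompact hinf
    (isCompact_closedBall (0 : ℂ) r) inter_subset_left
  rw [accPt_iff_frequently_nhdsNE] at hz
  have h1 : EqOn g 0 univ :=
    AnalyticOnNhd.eqOn_zero_of_preconnected_of_frequently_eq_zero
      (fun z _ => hg.analyticAt z) isPreconnected_univ (mem_univ z)
      (hz.mono fun w hw => hw.2)
  exact hg0 (h1 (mem_univ 0))

/-- At the origin the exponent is n + 1, so it is exempt from the bound; it never lies on the path.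
Elsewhere the exponent is the order of vanishing of g(w/x), and an order of at least two would make
the derivative vanish. -/
lemma exists_pole_order (hg : Differentiable ℂ g) (hg0 : g 0 ≠ 0) (hx : x ≠ 0) (n : ℕ) (a : ℂ) :
    ∃ N : ℕ, (a ≠ 0 → deriv g (a / x) ≠ 0 → N ≤ 1) ∧ ∃ h : ℂ → ℂ, AnalyticAt ℂ h a ∧
      ∀ᶠ z in 𝓝[≠] a, planeIntegrand g x n z = h z / (z - a) ^ N := by
  have hexp : ∀ b : ℂ, AnalyticAt ℂ (fun w : ℂ => cexp (n * w)) b := fun b => by fun_prop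
  have hk : Differentiable ℂ fun w : ℂ => g (w / x) := hg.comp (by fun_prop)
  rcases eq_or_ne a 0 with rfl | ha
  · refine ⟨n + 1, fun h => absurd rfl h, fun w => cexp (n * w) / g (w / x),
      (hexp 0).div (hk.analyticAt 0) (by simpa using hg0), Eventually.of_forall fun z => ?_⟩
    rw [planeIntegrand, sub_zero]
  · have hne : ¬ ∀ᶠ w in 𝓝 a, g (w / x) = 0 := fun h => by
      have h1 : EqOn (fun w : ℂ => g (w / x)) 0 univ :=
        AnalyticOnNhd.eqOn_zero_of_preconnected_of_eventuallyEq_zero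
          (fun z _ => hk.analyticAt z) isPreconnected_univ (mem_univ a) h
      exact hg0 (by simpa using h1 (mem_univ 0))
    obtain ⟨m, k, hka, hk0, hev⟩ :=
      (hk.analyticAt a).exists_eventuallyEq_pow_smul_nonzero_iff.2 hne
    refine ⟨m, fun _ hd => ?_, fun w => cexp (n * w) / k w / w ^ (n + 1),
      ((hexp a).div hka hk0).div (analyticAt_id.pow _) (pow_ne_zero _ ha), ?_⟩
    · by_contra! hm
      apply hd
      have h1 : HasDerivAt (fun w : ℂ => g (w / x)) (deriv g (a / x) * (1 / x)) a :=
        HasDerivAt.comp a (hg (a / x)).hasDerivAt ((hasDerivAt_id a).div_const x)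
      have h2 : HasDerivAt (fun w => (w - a) ^ m * k w) _ a :=
        (((hasDerivAt_id a).sub_const a).pow m).mul hka.differentiableAt.hasDerivAt
      have h3 := h1.unique (h2.congr_of_eventuallyEq hev)
      have h4 : m - 1 ≠ 0 := by omega
      have h5 : m ≠ 0 := by omega
      simpa [h4, h5, hx] using h3
    · filter_upwards [nhdsWithin_le_nhds hev] with z hz
      rw [planeIntegrand, hz, smul_eq_mul]
      simp only [div_eq_mul_inv, mul_inv]
      ring

/-- The zeros of `g(w/x)` in a disc, together with `0`. -/
noncomputable def polesFinset (hg : Differentiable ℂ g) (hg0 : g 0 ≠ 0) (x : ℂ) (r : ℝ) :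
    Finset ℂ :=
  open Classical in
  insert 0 (Set.Finite.toFinset (finite_zeros (g := fun w => g (w / x)) (hg.comp (by fun_prop))
    (by simpa using hg0) r))

lemma mem_polesFinset (hg : Differentiable ℂ g) (hg0 : g 0 ≠ 0) {r : ℝ} {a : ℂ} :
    a ∈ polesFinset hg hg0 x r ↔ a = 0 ∨ (‖a‖ ≤ r ∧ g (a / x) = 0) := by
  simp [polesFinset]

lemma differentiableOn_planeIntegrand (hg : Differentiable ℂ g) (hg0 : g 0 ≠ 0)
    (r : ℝ) : DifferentiableOn ℂ (planeIntegrand g x n)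
      (Metric.ball 0 r \ polesFinset hg hg0 x r) := by
  intro z hz
  have h1 : ¬ (z = 0 ∨ (‖z‖ ≤ r ∧ g (z / x) = 0)) := fun h =>
    hz.2 ((mem_polesFinset hg hg0).2 h)
  push Not at h1
  have h2 : g (z / x) ≠ 0 := h1.2 (by simpa using (mem_ball_zero_iff.1 hz.1).le)
  have hk : DifferentiableAt ℂ (fun w : ℂ => g (w / x)) z := (hg.comp (by fun_prop)) z
  exact (((by fun_prop : DifferentiableAt ℂ (fun w : ℂ => cexp (n * w)) z).div hk h2).div
    (by fun_prop : DifferentiableAt ℂ (fun w : ℂ => w ^ (n + 1)) z) (pow_ne_zero _ h1.1)).differentiableWithinAt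

/-- Substituting w = xz turns e^{nw}/g(w/x) into the generating function e^{nxz}/g(z); each
derivative costs a factor 1/x. -/
lemma iteratedDeriv_plane (g : ℂ → ℂ) (hx : x ≠ 0) (n : ℕ) :
    iteratedDeriv n (fun w => cexp (n * w) / g (w / x)) 0 = rescaledAppell g n x / x ^ n := by
  have h : (fun w => cexp (n * w) / g (w / x))
      = fun w => (fun z => cexp (n * x * z) / g z) (x⁻¹ * w) := by
    ext w
    have e1 : (n : ℂ) * x * (x⁻¹ * w) = n * w := by field_simp
    have e2 : x⁻¹ * w = w / x := by ring
    simp only [e1]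
    rw [e2]
  rw [h, iteratedDeriv_comp_mul_left (fun z => cexp (n * x * z) / g z) x⁻¹ n, rescaledAppell, appell]
  simp only [mul_zero, inv_pow]
  ring

lemma segmentContribution_eq (g : ℂ → ℂ) (x : ℂ) (n : ℕ) (T : ℝ) :
    segmentContribution g x n T = -I * arcInt (planeIntegrand g x n) T := by
  have h : ∀ X : ℝ, integrand g x n (X + (theta T).im * I)
      = -I * (planeIntegrand g x n (arcW T X) * (I * arcW T X)) := fun X => by
    rw [integrand_eq, arcW]
    linear_combination (cexp (I * (X + (theta T).im * I)) *
      planeIntegrand g x n (cexp (I * (X + (theta T).im * I)))) * I_mul_I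
  simp only [segmentContribution, h, intervalIntegral.integral_const_mul, arcInt]
  ring

/-- By -τ² = (e^{iθ} - iθ) - 1 on the curve, the integrand is e^{-n} F(θ) θ'. This is the origin of
the factor e^n in the theorem. -/
lemma curve_integrand_eq (g : ℂ → ℂ) (x : ℂ) (n : ℕ) (τ : ℝ) :
    deriv theta τ * cexp (-(n : ℂ) * (τ : ℂ) ^ 2) / g (cexp (I * theta τ) / x)
      = cexp (-n) * -I *
        (planeIntegrand g x n (curveW τ) * (I * curveW τ * deriv theta τ)) := by
  have h1 := theta_eq τ
  have h2 : -(n : ℂ) * (τ : ℂ) ^ 2 = -n + n * (cexp (I * theta τ) - I * theta τ) := by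
    rw [h1]; ring
  have h3 := congrFun (integrand_eq g x n) (theta τ)
  rw [h2, Complex.exp_add]
  rw [integrand] at h3
  have h4 : deriv theta τ * (cexp (-n) * cexp (n * (cexp (I * theta τ) - I * theta τ))) /
      g (cexp (I * theta τ) / x) = deriv theta τ * cexp (-n) *
        (cexp (n * (cexp (I * theta τ) - I * theta τ)) / g (cexp (I * theta τ) / x)) := by ring
  rw [h4, h3, curveW]
  linear_combination (deriv theta τ * cexp (-n) * cexp (I * theta τ) *
    planeIntegrand g x n (cexp (I * theta τ))) * I_mul_I

lemma finite_curve_zeros (hg : Differentiable ℂ g) (hg0 : g 0 ≠ 0) (x : ℂ) (M : ℝ) :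
    ({τ : ℝ | g (cexp (I * theta τ) / x) = 0} ∩ Icc (-M) M).Finite := by
  obtain ⟨r, hr⟩ := (isCompact_Icc (a := -M) (b := M)).exists_bound_of_continuousOn
    continuous_curveW.continuousOn
  refine Set.Finite.of_finite_image (f := curveW) ?_ curveW_injective.injOn
  refine (polesFinset hg hg0 x r).finite_toSet.subset ?_
  rintro _ ⟨τ, hτ, rfl⟩
  exact (mem_polesFinset hg hg0).2 (Or.inr ⟨hr τ hτ.2, hτ.1⟩)

lemma norm_le_of_mem_closedPath {T : ℝ} (hT : 0 < T) {w : ℂ} (hw : w ∈ closedPath T) :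
    ‖w‖ ≤ Real.exp (-(theta T).im) := by
  obtain ⟨h1, h2⟩ := log_norm_eq_of_mem_closedPath hT hw
  rw [← Real.log_le_iff_le_exp (norm_pos_iff.2 h1), h2]
  exact pathLogRadius_le hT _

/-- The sum of the weighted residues in terms of the coefficients of the simple fractions. -/
lemma residueSum_eq (hg : Differentiable ℂ g) (hg0 : g 0 ≠ 0) (hx : x ≠ 0) (T : ℝ) {r : ℝ}
    (hr : Real.exp (-(theta T).im) < r) {c E : ℂ → ℂ}
    (hE : ∀ z ∈ Metric.ball (0 : ℂ) r \ polesFinset hg hg0 x r, HasDerivAt E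
      (planeIntegrand g x n z - ∑ a ∈ polesFinset hg hg0 x r, c a / (z - a)) z) :
    residueSum g x n T
      = ∑ a ∈ (polesFinset hg hg0 x r).erase 0, (levelWeight T a : ℂ) * (-I * c a) := by
  classical
  set Z := polesFinset hg hg0 x r with hZ
  set A : Set ℂ := {ζ : ℂ | g ζ = 0 ∧ (theta T).im < (thetaZero x ζ).im} with hA
  set H : ℂ → ℂ := fun a => (weight (thetaZero 1 a) : ℂ) * residue (integrand g x n) (thetaZero 1 a)
    with hH
  have h1 : residueSum g x n T = ∑ᶠ ζ ∈ A, H (x * ζ) := by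
    simp only [residueSum, thetaZero_eq_one_mul x, hH, hA]
  -- The map ζ ↦ xζ carries the zeros above the height Im θ(T) to those nonzero poles with |a| <
  -- e^{-Im θ(T)}, all inside the disc; so the sum is finite.
  have h2 : (x * ·) '' A = ↑((Z.erase 0).filter fun a => (theta T).im < (thetaZero 1 a).im) := by
    ext a
    simp only [mem_image, Finset.coe_filter, Finset.mem_erase, hZ, mem_polesFinset]
    constructor
    · rintro ⟨ζ, ⟨hζ, him⟩, rfl⟩
      have hζ0 : ζ ≠ 0 := fun h => hg0 (h ▸ hζ)
      have ha0 : x * ζ ≠ 0 := mul_ne_zero hx hζ0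
      rw [thetaZero_eq_one_mul] at him
      refine ⟨⟨ha0, Or.inr ⟨?_, by rwa [mul_div_cancel_left₀ _ hx]⟩⟩, him⟩
      rw [thetaZero_im, one_mul] at him
      have := (Real.log_lt_iff_lt_exp (norm_pos_iff.2 ha0)).1
        (show Real.log ‖x * ζ‖ < -(theta T).im by linarith)
      exact (this.trans hr).le
    · rintro ⟨⟨h0, h3⟩, him⟩
      refine ⟨a / x, ⟨(h3.resolve_left h0).2, ?_⟩, by field_simp⟩
      rw [thetaZero_eq_one_mul, mul_div_cancel₀ _ hx]
      exact him
  rw [h1, ← finsum_mem_image (f := H) (g := (x * ·)) ((mul_right_injective₀ hx).injOn), h2,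
    finsum_mem_coe_finset, Finset.sum_filter]
  refine Finset.sum_congr rfl fun a ha => ?_
  have ha0 : a ≠ 0 := Finset.ne_of_mem_erase ha
  have haZ : a ∈ Z := Finset.mem_of_mem_erase ha
  rw [levelWeight]
  split_ifs with him
  · rw [thetaZero_im, one_mul] at him
    have hb : a ∈ Metric.ball (0 : ℂ) r := by
      rw [mem_ball_zero_iff]
      have := (Real.log_lt_iff_lt_exp (norm_pos_iff.2 ha0)).1
        (show Real.log ‖a‖ < -(theta T).im by linarith)
      exact this.trans hr
    have hea := exp_thetaZero ha0
    have := residue_exp_mul (differentiableOn_planeIntegrand hg hg0 r) hE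
      (θ₀ := thetaZero 1 a) (by rwa [hea]) (by rwa [hea])
    rw [hH]
    simp only []
    rw [integrand_eq, this, hea]
  · simp

/-- The principal value up to level `T`, in closed form. -/
theorem hasPVIntegralUpTo_level (hg : Differentiable ℂ g) (hg0 : g 0 ≠ 0) (hx : x ≠ 0) (n : ℕ)
    (hsimple : ∀ ζ : ℂ, g ζ = 0 → thetaZero x ζ ∈ curveC → deriv g ζ ≠ 0) {T : ℝ} (hT : 0 < T)
    (hfree : SegmentsFree g x T) :
    HasPVIntegralUpTo
      (fun τ : ℝ => deriv theta τ * cexp (-(n : ℂ) * (τ : ℂ) ^ 2) / g (cexp (I * theta τ) / x))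
      {τ : ℝ | g (cexp (I * theta τ) / x) = 0} T
      (cexp (-n) * (2 * Real.pi * (rescaledAppell g n x / x ^ n / n.factorial)
        + 2 * Real.pi * I * residueSum g x n T - segmentContribution g x n T)) := by
  classical
  set P : Set ℝ := {τ : ℝ | g (cexp (I * theta τ) / x) = 0} with hPdef
  have hP := finite_curve_zeros hg hg0 x
  -- The path lies in the disc of radius e^{-Im θ(T)}; the added 1 puts it inside the open disc.
  set r := Real.exp (-(theta T).im) + 1 with hr
  have hrT : Real.exp (-(theta T).im) < r := by linarith
  have hr0 : 0 < r := (Real.exp_pos _).trans hrT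
  set Z := polesFinset hg hg0 x r with hZ
  set G := planeIntegrand g x n with hG
  have hGd : DifferentiableOn ℂ G (Metric.ball 0 r \ Z) :=
    differentiableOn_planeIntegrand hg hg0 r
  choose N hN1 hNh using exists_pole_order hg hg0 hx n
  obtain ⟨c, E, hE1, hE2⟩ := exists_partialFraction N Z G hGd fun a _ => hNh a
  have hZ0 : (0 : ℂ) ∈ Z := (mem_polesFinset hg hg0).2 (Or.inl rfl)
  -- the poles and the path
  have hball : ∀ w ∈ closedPath T, w ∈ Metric.ball (0 : ℂ) r := fun w hw =>
    mem_ball_zero_iff.2 ((norm_le_of_mem_closedPath hT hw).trans_lt hrT)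
  have harc : ∀ a ∈ Z, a ∉ arcW T '' arcParams T := by
    rintro a ha ⟨X, hX, rfl⟩
    exact hfree X hX (((mem_polesFinset hg hg0).1 ha).resolve_left (arcW_ne_zero T X)).2
  have hon : ∀ a ∈ Z, ∀ p, curveW p = a → p ∈ P := by
    rintro a ha p rfl
    exact (((mem_polesFinset hg hg0).1 ha).resolve_left (curveW_ne_zero p)).2
  -- Poles on the path are simple: those on the curve by the simplicity hypothesis, and the arcs
  -- carry none. Hence E is holomorphic there.
  have hpathN : ∀ w ∈ closedPath T, w ∈ Z → N w ≤ 1 := by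
    rintro w (⟨p, hp, rfl⟩ | hw) hwZ
    · have h0 := curveW_ne_zero p
      refine hN1 _ h0 (hsimple _ (hon _ hwZ p rfl) ?_)
      rw [thetaZero_eq_one_mul, mul_div_cancel₀ _ hx, thetaZero_curveW]
      exact bijOn_theta.mapsTo (mem_univ p)
    · exact absurd hw (harc w hwZ)
  -- the primitive
  have hEan : ∀ w ∈ closedPath T, AnalyticAt ℂ E w := fun w hw => by
    have hopen : IsOpen (Metric.ball (0 : ℂ) r \ ((Z.filter fun a => ¬ N a ≤ 1 : Finset ℂ) : Set ℂ)) :=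
      Metric.isOpen_ball.sdiff (Finset.finite_toSet _).isClosed
    refine DifferentiableOn.analyticAt (s := Metric.ball (0 : ℂ) r \
      ((Z.filter fun a => ¬ N a ≤ 1 : Finset ℂ) : Set ℂ)) (fun z hz =>
        (hE1 z hz.1 fun h => ?_).differentiableWithinAt) (hopen.mem_nhds ⟨hball w hw, fun h => ?_⟩)
    · by_contra h2
      exact hz.2 (Finset.mem_coe.2 (Finset.mem_filter.2 ⟨h, h2⟩))
    · obtain ⟨h1, h2⟩ := Finset.mem_filter.1 (Finset.mem_coe.1 h)
      exact h2 (hpathN w hw h1)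
  have hEc : ∀ w ∈ closedPath T, ContinuousAt (deriv E) w := fun w hw =>
    (hEan w hw).deriv.continuousAt
  have hEclosed : curveInt (deriv E) T + arcInt (deriv E) T = 0 :=
    closed_integral_of_primitive hT (fun w hw => (hEan w hw).differentiableAt.hasDerivAt) hEc
  have hEcont : ContinuousOn
      (fun τ => deriv E (curveW τ) * (I * curveW τ * deriv theta τ)) (Icc (-T) T) := fun τ hτ =>
    (((hEc _ (Or.inl ⟨τ, hτ, rfl⟩)).comp continuous_curveW.continuousAt).mul
      ((continuous_const.mul continuous_curveW).mul
        continuous_deriv_theta).continuousAt).continuousWithinAt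
  have hpvE := hasPVIntegralUpTo_of_continuousOn hP hT.le hEcont
  -- the simple fractions
  have hpvZ := HasPVIntegralUpTo.sum Z
    (fun a ha => (hasPV_simpleFraction hP hT (harc a ha) (hon a ha)).const_mul (c a))
    (fun a ha => continuousOn_const.mul (continuousOn_simpleFraction (hon a ha)))
  have hpv := ((hpvZ.add hpvE (continuousOn_finsetSum _ fun a ha =>
    continuousOn_const.mul (continuousOn_simpleFraction (hon a ha)))
    (hEcont.mono sdiff_subset)).const_mul (cexp (-n) * -I)).congr
    (g := fun τ : ℝ =>
      deriv theta τ * cexp (-(n : ℂ) * (τ : ℂ) ^ 2) / g (cexp (I * theta τ) / x)) (by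
      intro τ hτ
      have hw : curveW τ ∈ closedPath T := Or.inl ⟨τ, hτ.1, rfl⟩
      have hwZ : curveW τ ∉ Z := fun h => hτ.2 (hon _ h τ rfl)
      simp only [curve_integrand_eq]
      rw [(hE2 _ ⟨hball _ hw, hwZ⟩).deriv, sub_mul, Finset.sum_mul, ← hG]
      simp only [div_eq_mul_inv, mul_assoc, add_sub_cancel])
  convert hpv using 1
  -- the arcs
  have hk1 : ∀ a ∈ Z, ContinuousOn (fun w => c a * (w - a)⁻¹) (arcW T '' arcParams T) :=
    fun a ha => continuousOn_const.mul (ContinuousOn.inv₀ (by fun_prop) fun w hw =>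
      sub_ne_zero.2 fun h => harc a ha (h ▸ hw))
  have hseg : segmentContribution g x n T
      = -I * (∑ a ∈ Z, c a * arcInt (fun w => (w - a)⁻¹) T + arcInt (deriv E) T) := by
    rw [segmentContribution_eq, ← hG]
    congr 1
    have h1 : arcInt G T = arcInt (fun w => (∑ a ∈ Z, c a * (w - a)⁻¹) + deriv E w) T := by
      refine arcInt_congr fun w hw => ?_
      have hwZ : w ∉ Z := fun h => harc w h hw
      rw [(hE2 w ⟨hball w (Or.inr hw), hwZ⟩).deriv]
      simp only [div_eq_mul_inv, add_sub_cancel]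
    rw [h1, arcInt_add (continuousOn_finsetSum _ hk1) (fun w hw =>
      (hEc w (Or.inr hw)).continuousWithinAt), arcInt_sum Z hk1]
    simp only [arcInt_const_mul (fun w => (w - _)⁻¹)]
  have hres := residueSum_eq (n := n) hg hg0 hx T hrT hE2
  have hc0 : c 0 = rescaledAppell g n x / x ^ n / n.factorial := by
    have hk : Differentiable ℂ fun w : ℂ => g (w / x) := hg.comp (by fun_prop)
    rw [coeff_eq_iteratedDeriv (Φ := fun w => cexp (n * w) / g (w / x)) (n := n)
      ((by fun_prop : AnalyticAt ℂ (fun w : ℂ => cexp (n * w)) 0).div (hk.analyticAt 0)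
        (by simpa using hg0)) hGd (fun z => rfl) hE2 hr0 hZ0, iteratedDeriv_plane g hx]
  rw [hres, hseg, ← hc0]
  -- The origin is separated from the other poles: it always has winding number 1 and yields the
  -- Appell coefficient, and the rest is the residue sum.
  have hsplit : ∑ a ∈ Z, c a * (2 * Real.pi * I * ((if a = 0 then 1 else levelWeight T a : ℝ) : ℂ)
      - arcInt (fun w => (w - a)⁻¹) T)
      = 2 * Real.pi * I * (c 0 + ∑ a ∈ Z.erase 0, c a * levelWeight T a)
        - ∑ a ∈ Z, c a * arcInt (fun w => (w - a)⁻¹) T := by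
    have h1 : ∑ a ∈ Z, c a * ((if a = 0 then 1 else levelWeight T a : ℝ) : ℂ)
        = c 0 + ∑ a ∈ Z.erase 0, c a * levelWeight T a := by
      rw [← Finset.add_sum_erase Z _ hZ0, if_pos rfl, ofReal_one, mul_one]
      congr 1
      exact Finset.sum_congr rfl fun a ha => by rw [if_neg (Finset.ne_of_mem_erase ha)]
    rw [← h1, Finset.mul_sum, ← Finset.sum_sub_distrib]
    exact Finset.sum_congr rfl fun a _ => by ring
  have hsum : ∑ a ∈ Z.erase 0, (levelWeight T a : ℂ) * (-I * c a)
      = -I * ∑ a ∈ Z.erase 0, c a * levelWeight T a := by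
    rw [Finset.mul_sum]
    exact Finset.sum_congr rfl fun a _ => by ring
  have hEc' : ∫ τ in (-T)..T, deriv E (curveW τ) * (I * curveW τ * deriv theta τ)
      = -arcInt (deriv E) T := by
    rw [← curveInt]
    linear_combination hEclosed
  rw [hsplit, hsum, hEc']
  linear_combination (2 * Real.pi * c 0 * cexp (-n)) * I_mul_I

end

end Appell

/-! ### The theorem: passage to the limit T → ∞ -/

theorem theorem2 :
    -- `θ` is a smooth regular parametrization of the steepest-descent curve by the real line,
    -- and it solves `e^{iθ} - iθ = 1 - τ²`
    (ContDiff ℝ ∞ Appell.theta ∧ (∀ τ : ℝ, deriv Appell.theta τ ≠ 0) ∧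
      BijOn Appell.theta univ Appell.curveC ∧
      (∀ τ : ℝ, cexp (I * Appell.theta τ) - I * Appell.theta τ = 1 - (τ : ℂ) ^ 2) ∧
      (∀ τ : ℝ, 0 < τ → ∀ ϑ : ℂ,
        (ϑ ∈ Appell.regionOmega ∧ cexp (I * ϑ) - I * ϑ = 1 - (τ : ℂ) ^ 2) ↔
          ϑ = Appell.theta τ) ∧
      -- on the points used, `W` is the branch of the Lambert function with values in `regionR`
      (∀ τ : ℝ, 0 < τ → ∀ w : ℂ,
        (w ∈ Appell.regionR ∧ w * cexp w = -cexp ((τ : ℂ) ^ 2 - 1)) ↔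
          w = Appell.lambertW (-cexp ((τ : ℂ) ^ 2 - 1)))) ∧
    -- the representation of the rescaled Appell polynomials
    ∀ (g : ℂ → ℂ), Differentiable ℂ g → g 0 ≠ 0 → ∀ (x : ℂ), x ≠ 0 → ∀ (n : ℕ),
      -- the zeros on the curve are simple
      (∀ ζ : ℂ, g ζ = 0 → Appell.thetaZero x ζ ∈ Appell.curveC → deriv g ζ ≠ 0) →
      -- the contribution of the horizontal segments vanishes along an unbounded set of levels
      ∀ (S : Set ℝ), (∀ T ∈ S, 0 < T ∧ Appell.SegmentsFree g x T) →
      (∀ M : ℝ, ∃ T ∈ S, M < T) →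
      Tendsto (Appell.segmentContribution g x n) (atTop ⊓ 𝓟 S) (𝓝 0) →
      -- the sum of the residues converges
      ∀ (R : ℂ), Tendsto (Appell.residueSum g x n) (atTop ⊓ 𝓟 S) (𝓝 R) →
      ∃ J : ℂ,
        Appell.HasPVIntegral
          (fun τ : ℝ => deriv Appell.theta τ * cexp (-(n : ℂ) * (τ : ℂ) ^ 2)
            / g (cexp (I * Appell.theta τ) / x))
          {τ : ℝ | g (cexp (I * Appell.theta τ) / x) = 0} S J ∧
        Appell.rescaledAppell g n x / (n.factorial : ℂ)
          = x ^ n / (2 * Real.pi) * (cexp n * J - 2 * Real.pi * I * R) := by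
  refine ⟨⟨Appell.contDiff_theta, fun τ h => ?_, Appell.bijOn_theta, Appell.theta_eq,
    fun τ hτ ϑ => Appell.omega_iff hτ ϑ, fun τ hτ w => Appell.regionR_iff hτ w⟩, ?_⟩
  · have := Appell.deriv_theta_re_pos τ
    rw [h] at this
    simp at this
  · intro g hg hg0 x hx n hsimple S hS _ hseg R hR
    -- The value J is the limit of the closed formula at level T: the residue sums tend to R and the
    -- segment term to 0. Solving for the Appell polynomial gives the representation.
    refine ⟨cexp (-n) * (2 * Real.pi * (Appell.rescaledAppell g n x / x ^ n / n.factorial)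
      + 2 * Real.pi * I * R), ⟨_, fun T hT =>
        Appell.hasPVIntegralUpTo_level hg hg0 hx n hsimple (hS T hT).1 (hS T hT).2, ?_⟩, ?_⟩
    · have := ((tendsto_const_nhds (x := 2 * (Real.pi : ℂ) *
        (Appell.rescaledAppell g n x / x ^ n / n.factorial))).add
        (hR.const_mul (2 * Real.pi * I))).sub hseg
      rw [sub_zero] at this
      exact this.const_mul (cexp (-n))
    · have hpi : (Real.pi : ℂ) ≠ 0 := by exact_mod_cast Real.pi_ne_zero
      have h1 : cexp n * cexp (-n) = 1 := by rw [← Complex.exp_add]; simp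
      rw [← mul_assoc, h1]
      have hn : (n.factorial : ℂ) ≠ 0 := by exact_mod_cast n.factorial_ne_zero
      field_simp
      ring
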